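/- All graphs are finite, nonempty, simple and undirected, and are considered up to isomorphism. Let $k\ge 1$ be an integer. A \emph{$k$-expression} builds a graph with vertex labels in $\{1,\dots,k\}$ from atoms creating a single vertex with a label $i$, using the operations $\eta_{i,j}$ for $i\neq j$ (add all edges between vertices labeled $i$ and vertices labeled $j$), $\rho_{i\to j}$ (change all labels $i$ to $j$) and $\oplus$ (disjoint union). A \emph{$k$-fusion-tree expression} is built with the same operations $\eta_{i,j}$, $\rho_{i\to j}$, $\oplus$ from atoms creating $m$ isolated vertices with a label $i$, together with one further unary operation $\theta_i$, which merges all vertices labeled $i$ (if there are any) into one vertex; the new vertex is labeled $i$ and is adjacent to exactly those vertices not labeled $i$ to which some vertex labeled $i$ was adjacent before. The graph generated by an expression is obtained by deleting the labels at the end. The \emph{clique-width} $\mathrm{cw}(G)$ is the smallest $k$ such that some $k$-expression generates $G$, and the \emph{fusion-width} $\mathrm{fw}(G)$ is the smallest $k$ such that some $k$-fusion-tree expression generates $G$. \textbf{Corollary.} For every integer $k\ge 1$ there is a graph $G$ with $$\mathrm{fw}(G)=k\qquad\text{and}\qquad \mathrm{cw}(G)\ \ge\ 2^{\lfloor k/2\rfloor-2}.$$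 -/

import Mathlib

namespace FusionWidth

/-- A simple graph whose vertices carry labels from a set of `k` labels. -/
structure LabeledGraph (k : ℕ) where
  V : Type
  graph : SimpleGraph V
  label : V → Fin k

namespace LabeledGraph

variable {k : ℕ}

/-- `m` isolated vertices, all labeled `i`. -/
def isolated (i : Fin k) (m : ℕ) : LabeledGraph k where
  V := Fin m
  graph := ⊥
  label := fun _ => i

/-- Join every vertex labeled `i` to every vertex labeled `j`, keeping the old edges
(used only for `i ≠ j`). -/
def addEdges (i j : Fin k) (A : LabeledGraph k) : LabeledGraph k where
  V := A.V
  graph := A.graph ⊔ SimpleGraph.fromRel (fun x y => A.label x = i ∧ A.label y = j)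
  label := A.label

/-- Change all labels `i` to `j`. -/
def relabel (i j : Fin k) (A : LabeledGraph k) : LabeledGraph k where
  V := A.V
  graph := A.graph
  label := fun x => if A.label x = i then j else A.label x

/-- Two vertices are identified by merging label `i` if they are equal or both labeled `i`. -/
def mergeSetoid (i : Fin k) (A : LabeledGraph k) : Setoid A.V where
  r x y := x = y ∨ (A.label x = i ∧ A.label y = i)
  iseqv :=
    { refl := fun _ => Or.inl rfl
      symm := by
        rintro x y (h | ⟨h₁, h₂⟩)
        · exact Or.inl h.symm
        · exact Or.inr ⟨h₂, h₁⟩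
      trans := by
        rintro x y z (rfl | ⟨h₁, h₂⟩) (rfl | ⟨h₃, h₄⟩)
        · exact Or.inl rfl
        · exact Or.inr ⟨h₃, h₄⟩
        · exact Or.inr ⟨h₁, h₂⟩
        · exact Or.inr ⟨h₁, h₄⟩ }

/-- Merge all vertices labeled `i` into one vertex labeled `i`. Two distinct vertices of the result
are adjacent if some of their representatives were. Nothing happens if no vertex is labeled `i`. -/
def merge (i : Fin k) (A : LabeledGraph k) : LabeledGraph k where
  V := Quotient (A.mergeSetoid i)
  graph := SimpleGraph.fromRel fun a b =>
    ∃ x y : A.V, Quotient.mk (A.mergeSetoid i) x = a ∧ Quotient.mk (A.mergeSetoid i) y = b ∧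
      A.graph.Adj x y
  label := Quotient.lift A.label (by
    rintro x y (h | ⟨h₁, h₂⟩)
    · exact congrArg A.label h
    · exact h₁.trans h₂.symm)

/-- Disjoint union. -/
def disjUnion (A B : LabeledGraph k) : LabeledGraph k where
  V := A.V ⊕ B.V
  graph := SimpleGraph.sum A.graph B.graph
  label := Sum.elim A.label B.label

end LabeledGraph

/-- The `k`-expressions. -/
inductive CliqueExpr (k : ℕ) : Type
  | vertex (i : Fin k)
  | addEdges (i j : Fin k) (hij : i ≠ j) (e : CliqueExpr k)
  | relabel (i j : Fin k) (e : CliqueExpr k)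
  | disjUnion (e f : CliqueExpr k)

/-- The labeled graph built by a `k`-expression. -/
def CliqueExpr.eval {k : ℕ} : CliqueExpr k → LabeledGraph k
  | .vertex i => LabeledGraph.isolated i 1
  | .addEdges i j _ e => e.eval.addEdges i j
  | .relabel i j e => e.eval.relabel i j
  | .disjUnion e f => e.eval.disjUnion f.eval

/-- The `k`-fusion-tree expressions. -/
inductive FusionExpr (k : ℕ) : Type
  | isolated (i : Fin k) (m : ℕ)
  | addEdges (i j : Fin k) (hij : i ≠ j) (e : FusionExpr k)
  | relabel (i j : Fin k) (e : FusionExpr k)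
  | merge (i : Fin k) (e : FusionExpr k)
  | disjUnion (e f : FusionExpr k)

/-- The labeled graph built by a `k`-fusion-tree expression. -/
def FusionExpr.eval {k : ℕ} : FusionExpr k → LabeledGraph k
  | .isolated i m => LabeledGraph.isolated i m
  | .addEdges i j _ e => e.eval.addEdges i j
  | .relabel i j e => e.eval.relabel i j
  | .merge i e => e.eval.merge i
  | .disjUnion e f => e.eval.disjUnion f.eval

/-- The clique-width of a finite nonempty graph: the smallest `k` such that some `k`-expression
generates the graph (up to isomorphism, and after deleting the labels). -/
noncomputable def cliqueWidth {V : Type*} (G : SimpleGraph V) : ℕ :=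
  sInf {k : ℕ | ∃ e : CliqueExpr k, Nonempty (e.eval.graph ≃g G)}

/-- The fusion-width of a finite graph: the smallest `k` such that some `k`-fusion-tree
expression generates the graph (up to isomorphism, and after deleting the labels). -/
noncomputable def fusionWidth {V : Type*} (G : SimpleGraph V) : ℕ :=
  sInf {k : ℕ | ∃ e : FusionExpr k, Nonempty (e.eval.graph ≃g G)}

end FusionWidth

/-! The witness is a ternary tree of large height `h` over stars whose leaves realise all `2 ^ P`
types in `Fin P → Bool`, with `p ≤ P` apex vertices added; apex `s` sees exactly the leaves whose
type is true at `s`.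

Upper bound: the tree needs 3 labels, and each added vertex costs at most one more
(`exists_fusionExpr_of_add_vertex`). Copies of the new vertex are created next to the atoms under a
fresh label and fused at the end.

Lower bounds: an expression decomposes the vertex set by unions `A ∪ B` in which every set is a cut
with few labels (`IsCut`). For clique-width `c` the parts are disjoint and `c` labels suffice; for
fusion-width `c` the parts share at most `c` vertices and `2 * c` labels suffice
(`CliqueExpr.cutTree`, `FusionExpr.cutTree`). With overlap at most `q`, one part misses at least `(p
- q) / 2` apices. If there are fewer than `2 ^ ((p - q) / 2)` labels, that part contains no vertex
of some type (`exists_missing_type`). Following the other part each time gives a chain of cuts from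
`∅` to everything, in which each increment misses a type (`CutTree.exists_chain`). Such a chain
cannot swallow a star in one step, and a pathwidth-style induction on the ternary tree then forces a
cut with more than `h` labels (`exists_lt_ncard_boundaryLabels`).

Hence the clique-width is at least `2 ^ (p / 2)`, while the fusion-width exceeds `k` once `p` is
large. It grows by at most one per apex, so the least `p` reaching `k` gives fusion-width exactly
`k`, with `p ≥ k - 3`. The cases `k < 3` are trivial, as the claimed bound is then at most 1. -/

namespace FusionWidth

/-! ### From expressions to trees and chains of cuts -/

open Set

variable {V : Type*} {k : ℕ}

/-- The vertices of `B` can be labeled by `α` so that vertices with the same label have the same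
neighbours outside `B`. -/
def IsCut (G : SimpleGraph V) (α : Type*) (B : Set V) : Prop :=
  ∃ l : V → α, ∀ x ∈ B, ∀ y ∈ B, l x = l y → ∀ z ∉ B, (G.Adj x z ↔ G.Adj y z)

/-- Sets of vertices obtained from single vertices by unions of almost disjoint sets, such that all
intermediate sets are cuts. -/
inductive CutTree (G : SimpleGraph V) (α : Type*) (q : ℕ) : Set V → Prop
  | empty : IsCut G α ∅ → CutTree G α q ∅
  | single (v : V) : IsCut G α {v} → CutTree G α q {v}
  | union (A B : Set V) : CutTree G α q A → CutTree G α q B → (A ∩ B).ncard ≤ q →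
      IsCut G α (A ∪ B) → CutTree G α q (A ∪ B)

theorem CutTree.isCut {G : SimpleGraph V} {α : Type*} {q : ℕ} {A : Set V}
    (h : CutTree G α q A) : IsCut G α A := by
  cases h <;> assumption

/-- The labeled graph `A` is an intermediate stage in the construction of `G`, where `φ` maps the
vertices of `A` to the vertices of `G` which they become. -/
def Traces (G : SimpleGraph V) (A : LabeledGraph k) (φ : A.V → V) : Prop :=
  (∀ x y, x ≠ y → φ x = φ y → ∀ w, A.label w = A.label x → φ w = φ x) ∧
  -- Label classes sent to a single vertex are exempt: that vertex may still be fused with vertices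
  -- built elsewhere and inherit their neighbours.
  ∃ N : Fin k → V → Prop, ∀ x, (∃ w, A.label w = A.label x ∧ φ w ≠ φ x) → ∀ z, z ≠ φ x →
    (G.Adj (φ x) z ↔ (∃ b, φ b = z ∧ A.graph.Adj x b) ∨ N (A.label x) z)

namespace Traces

variable {G : SimpleGraph V} {A A₁ A₂ : LabeledGraph k}

/-- The root of a top-down induction: the lemmas below pass `Traces` from an expression to its
subexpressions, enlarging `N` by the edges still to be added. -/
theorem of_iso (f : A.graph ≃g G) : Traces G A f := by
  refine ⟨fun x y h h' => absurd (f.injective h') h, fun _ _ => False, ?_⟩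
  intro x _ z _
  obtain ⟨b, rfl⟩ := f.surjective z
  simpa using f.map_rel_iff

theorem addEdges {i j : Fin k} {φ : A.V → V} (h : Traces G (A.addEdges i j) φ) :
    Traces G A φ := by
  obtain ⟨h₁, N, h₂⟩ := h
  refine ⟨h₁, fun l z => N l z ∨ (l = i ∧ ∃ b, φ b = z ∧ A.label b = j) ∨
    (l = j ∧ ∃ b, φ b = z ∧ A.label b = i), ?_⟩
  intro x hx z hz
  refine (h₂ x hx z hz).trans ?_
  have key : ∀ b, φ b = z → ((A.addEdges i j).graph.Adj x b ↔ A.graph.Adj x b ∨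
      ((A.label x = i ∧ A.label b = j) ∨ (A.label b = i ∧ A.label x = j))) := by
    intro b hb
    have : x ≠ b := by rintro rfl; exact hz hb.symm
    simp [LabeledGraph.addEdges, SimpleGraph.fromRel_adj, this]
  constructor
  · rintro (⟨b, hb, hxb⟩ | h)
    · rcases (key b hb).1 hxb with h | h | h
      · exact Or.inl ⟨b, hb, h⟩
      · exact Or.inr (Or.inr (Or.inl ⟨h.1, b, hb, h.2⟩))
      · exact Or.inr (Or.inr (Or.inr ⟨h.2, b, hb, h.1⟩))
    · exact Or.inr (Or.inl h)
  · rintro (⟨b, hb, h⟩ | h | ⟨h, b, hb, h'⟩ | ⟨h, b, hb, h'⟩)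
    · exact Or.inl ⟨b, hb, (key b hb).2 (Or.inl h)⟩
    · exact Or.inr h
    · exact Or.inl ⟨b, hb, (key b hb).2 (Or.inr (Or.inl ⟨h, h'⟩))⟩
    · exact Or.inl ⟨b, hb, (key b hb).2 (Or.inr (Or.inr ⟨h', h⟩))⟩

theorem relabel {i j : Fin k} {φ : A.V → V} (h : Traces G (A.relabel i j) φ) :
    Traces G A φ := by
  obtain ⟨h₁, N, h₂⟩ := h
  have hl : ∀ x y, A.label x = A.label y → (A.relabel i j).label x = (A.relabel i j).label y := by
    intro x y h
    simp [LabeledGraph.relabel, h]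
  refine ⟨fun x y hxy hφ w hw => h₁ x y hxy hφ w (hl _ _ hw),
    fun l z => N (if l = i then j else l) z, ?_⟩
  rintro x ⟨w, hw, hφ⟩ z hz
  exact h₂ x ⟨w, hl _ _ hw, hφ⟩ z hz

/-- The class `i` collapses, so the condition on `N` concerns only vertices with other labels, whose
fibres in the quotient are singletons. -/
theorem merge {i : Fin k} {φ : (A.merge i).V → V} (h : Traces G (A.merge i) φ) :
    Traces G A (fun x => φ (Quotient.mk (A.mergeSetoid i) x)) := by
  obtain ⟨h₁, N, h₂⟩ := h
  have hmk : ∀ x y, A.label x = i → A.label y = i →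
      Quotient.mk (A.mergeSetoid i) x = Quotient.mk (A.mergeSetoid i) y :=
    fun x y hx hy => Quotient.sound (s := A.mergeSetoid i) (Or.inr ⟨hx, hy⟩)
  have hmk' : ∀ x y, Quotient.mk (A.mergeSetoid i) x = Quotient.mk (A.mergeSetoid i) y →
      x = y ∨ (A.label x = i ∧ A.label y = i) :=
    fun x y h => Quotient.exact (s := A.mergeSetoid i) h
  refine ⟨?_, N, ?_⟩
  · intro x y hxy hφ w hw
    by_cases hq : Quotient.mk (A.mergeSetoid i) x = Quotient.mk (A.mergeSetoid i) y
    · rcases hmk' _ _ hq with h | h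
      · exact absurd h hxy
      · exact congrArg φ (hmk _ _ (hw.trans h.1) h.1)
    · exact h₁ _ _ hq hφ _ hw
  · rintro x ⟨w, hw, hφ⟩ z hz
    have hx : A.label x ≠ i := fun h => hφ (congrArg φ (hmk _ _ (hw.trans h) h))
    refine (h₂ (Quotient.mk (A.mergeSetoid i) x) ⟨Quotient.mk (A.mergeSetoid i) w, hw, hφ⟩ z
      hz).trans (or_congr ?_ Iff.rfl)
    constructor
    · rintro ⟨b, hb, hxb⟩
      obtain ⟨-, hxb⟩ := (SimpleGraph.fromRel_adj _ _ _).1 hxb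
      have : ∃ x' y', Quotient.mk (A.mergeSetoid i) x' = Quotient.mk (A.mergeSetoid i) x ∧
          Quotient.mk (A.mergeSetoid i) y' = b ∧ A.graph.Adj x' y' := by
        rcases hxb with h | ⟨x', y', h, h', ha⟩
        · exact h
        · exact ⟨y', x', h', h, ha.symm⟩
      obtain ⟨x', y', h, h', ha⟩ := this
      rcases hmk' _ _ h with rfl | h
      · exact ⟨y', (congrArg φ h').trans hb, ha⟩
      · exact absurd h.2 hx
    · rintro ⟨b, hb, hxb⟩
      refine ⟨Quotient.mk (A.mergeSetoid i) b, hb, (SimpleGraph.fromRel_adj _ _ _).2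
        ⟨?_, Or.inl ⟨x, b, rfl, rfl, hxb⟩⟩⟩
      intro h
      exact hz (hb.symm.trans (congrArg φ h.symm))

theorem comp {φ : A.V → V} (h : Traces G A φ) (f : A₁.V → A.V) (hf : Function.Injective f)
    (hl : ∀ x, A.label (f x) = A₁.label x)
    (ha : ∀ x b, A.graph.Adj (f x) b ↔ ∃ b', f b' = b ∧ A₁.graph.Adj x b') :
    Traces G A₁ (fun x => φ (f x)) := by
  obtain ⟨h₁, N, h₂⟩ := h
  refine ⟨fun x y hxy hφ w hw => h₁ (f x) (f y) (hf.ne hxy) hφ (f w) (by rw [hl, hl, hw]), N, ?_⟩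
  rintro x ⟨w, hw, hφ⟩ z hz
  refine (h₂ (f x) ⟨f w, by rw [hl, hl, hw], hφ⟩ z hz).trans ?_
  rw [hl]
  refine or_congr ⟨?_, ?_⟩ Iff.rfl
  · rintro ⟨b, hb, h⟩
    obtain ⟨b', rfl, h'⟩ := (ha _ _).1 h
    exact ⟨b', hb, h'⟩
  · rintro ⟨b, hb, h⟩
    exact ⟨f b, hb, (ha _ _).2 ⟨b, rfl, h⟩⟩

theorem inl {φ : (A₁.disjUnion A₂).V → V} (h : Traces G (A₁.disjUnion A₂) φ) :
    Traces G A₁ (fun x => φ (Sum.inl x)) := by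
  refine h.comp (A₁ := A₁) Sum.inl Sum.inl_injective (fun _ => rfl) ?_
  rintro x (b | b)
  · simp [LabeledGraph.disjUnion]
  · simp [LabeledGraph.disjUnion]

theorem inr {φ : (A₁.disjUnion A₂).V → V} (h : Traces G (A₁.disjUnion A₂) φ) :
    Traces G A₂ (fun x => φ (Sum.inr x)) := by
  refine h.comp (A₁ := A₂) Sum.inr Sum.inr_injective (fun _ => rfl) ?_
  rintro x (b | b)
  · simp [LabeledGraph.disjUnion]
  · simp [LabeledGraph.disjUnion]

/-- A vertex that is the image of a whole label class is determined by that label (`Sum.inl`); the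
others have outside neighbours given by `N` (`Sum.inr`), since no edge built so far leaves the
range. -/
theorem isCut_range {φ : A.V → V} (h : Traces G A φ) (i₀ : Fin k) :
    IsCut G (Fin k ⊕ Fin k) (range φ) := by
  classical
  obtain ⟨h₁, N, h₂⟩ := h
  let own : A.V → Prop := fun x => ∀ w, A.label w = A.label x → φ w = φ x
  refine ⟨fun v => if h : ∃ x, φ x = v ∧ own x then Sum.inl (A.label h.choose) else
    if h : ∃ x, φ x = v then Sum.inr (A.label h.choose) else Sum.inl i₀, ?_⟩
  intro u hu v hv huv z hz
  simp only [mem_range] at hu hv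
  by_cases hu' : ∃ x, φ x = u ∧ own x <;> by_cases hv' : ∃ x, φ x = v ∧ own x
  · simp only [hu', hv', dif_pos, Sum.inl.injEq] at huv
    have h := hu'.choose_spec.2 _ huv.symm
    rw [hu'.choose_spec.1, hv'.choose_spec.1] at h
    rw [h]
  · simp [hu', hv', hv] at huv
  · simp [hu', hv', hu] at huv
  · simp only [hu', hv', hu, hv, dif_pos, dif_neg, not_false_iff, Sum.inr.injEq] at huv
    have key : ∀ v, (hv : ∃ x, φ x = v) → (¬ ∃ x, φ x = v ∧ own x) →
        (G.Adj v z ↔ N (A.label hv.choose) z) := by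
      intro v hv hv'
      have hfree : ∃ w, A.label w = A.label hv.choose ∧ φ w ≠ φ hv.choose := by
        by_contra! hc
        exact hv' ⟨_, hv.choose_spec, hc⟩
      have := h₂ _ hfree z (fun h => hz ⟨_, h.symm⟩)
      rw [hv.choose_spec] at this
      rw [this]
      exact or_iff_right fun ⟨b, hb, _⟩ => hz ⟨b, hb⟩
    rw [key u hu hu', key v hv hv', huv]

theorem isCut_range_of_injective {φ : A.V → V} (h : Traces G A φ) (hφ : Function.Injective φ)
    (i₀ : Fin k) : IsCut G (Fin k) (range φ) := by
  obtain ⟨h₁, N, h₂⟩ := h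
  refine ⟨Function.extend φ A.label fun _ => i₀, ?_⟩
  rintro _ ⟨x, rfl⟩ _ ⟨y, rfl⟩ hxy z hz
  rw [hφ.extend_apply, hφ.extend_apply] at hxy
  by_cases h : x = y
  · rw [h]
  have hz' : ∀ x, z ≠ φ x := fun x h => hz ⟨x, h.symm⟩
  have hN : ∀ x, ¬ ∃ b, φ b = z ∧ A.graph.Adj x b := fun x ⟨b, hb, _⟩ => hz ⟨b, hb⟩
  rw [h₂ x ⟨y, hxy.symm, hφ.ne (Ne.symm h)⟩ z (hz' x), h₂ y ⟨x, hxy, hφ.ne h⟩ z (hz' y), hxy,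
    or_iff_right (hN x), or_iff_right (hN y)]

/-- A shared vertex has two distinct preimages, so it absorbs an entire label class; distinct shared
vertices therefore use distinct labels. -/
theorem ncard_inter_le {φ : A.V → V} (h : Traces G A φ) {X Y : Type*} (f : X → A.V) (g : Y → A.V)
    (hfg : ∀ x y, f x ≠ g y) :
    (range (fun x => φ (f x)) ∩ range (fun y => φ (g y))).ncard ≤ k := by
  obtain ⟨h₁, -⟩ := h
  set I := range (fun x => φ (f x)) ∩ range (fun y => φ (g y)) with hI
  have hx : ∀ v : I, ∃ x, φ (f x) = v := fun v => v.2.1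
  choose x hx using hx
  have : Function.Injective (fun v : I => A.label (f (x v))) := by
    intro v v' hvv
    obtain ⟨y, hy⟩ := v.2.2
    have := h₁ (f (x v)) (g y) (hfg _ _) ((hx v).trans hy.symm) (f (x v')) hvv.symm
    rw [hx, hx] at this
    exact Subtype.ext this.symm
  have := Nat.card_le_card_of_injective _ this
  simpa using this

end Traces

theorem range_sum {X Y : Type*} (φ : X ⊕ Y → V) :
    range φ = range (fun x => φ (Sum.inl x)) ∪ range (fun x => φ (Sum.inr x)) := by
  ext v
  simp

theorem isCut_of_forall (G : SimpleGraph V) {α : Type*} (a : α) (B : Set V)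
    (h : ∀ x ∈ B, ∀ y ∈ B, x = y) : IsCut G α B :=
  ⟨fun _ => a, fun x hx y hy _ z _ => by rw [h x hx y hy]⟩

theorem FusionExpr.nonempty_fin (e : FusionExpr k) : Nonempty (Fin k) := by
  induction e <;> first | assumption | exact ⟨by assumption⟩

theorem CliqueExpr.nonempty_fin (e : CliqueExpr k) : Nonempty (Fin k) := by
  induction e <;> first | assumption | exact ⟨by assumption⟩

/-- The atom is split into single vertices; some of them may be fused later, so even these unions
can overlap. -/
theorem cutTree_isolated {G : SimpleGraph V} (i : Fin k) (m : ℕ) (φ : Fin m → V)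
    (h : Traces G (LabeledGraph.isolated i m) φ) :
    CutTree G (Fin k ⊕ Fin k) k (range φ) := by
  induction m with
  | zero =>
    rw [range_eq_empty]
    exact .empty (isCut_of_forall G (Sum.inl i) _ (by simp))
  | succ m ih =>
    have h' : Traces G (LabeledGraph.isolated i m) (fun x : Fin m => φ x.castSucc) :=
      h.comp (A₁ := LabeledGraph.isolated i m) Fin.castSucc (Fin.castSucc_injective m)
        (fun _ => rfl) (by simp [LabeledGraph.isolated])
    have hc := h.ncard_inter_le (fun x : Fin m => x.castSucc) (fun _ : Unit => Fin.last m)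
      (fun x _ => (Fin.castSucc_lt_last x).ne)
    have hr : range φ = range (fun x : Fin m => φ x.castSucc) ∪
        range (fun _ : Unit => φ (Fin.last m)) := by
      ext v
      simp only [mem_range, mem_union]
      constructor
      · rintro ⟨x, rfl⟩
        induction x using Fin.lastCases with
        | last => exact Or.inr ⟨(), rfl⟩
        | cast x => exact Or.inl ⟨x, rfl⟩
      · rintro (⟨x, rfl⟩ | ⟨-, rfl⟩) <;> exact ⟨_, rfl⟩
    have hcut : IsCut G (Fin k ⊕ Fin k) (range φ) := h.isCut_range i
    rw [hr] at hcut ⊢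
    refine .union _ _ (ih _ h') ?_ hc hcut
    rw [range_const]
    exact .single _ (isCut_of_forall G (Sum.inl i) _ (by simp))

theorem FusionExpr.cutTree {G : SimpleGraph V} (e : FusionExpr k) (φ : e.eval.V → V)
    (h : Traces G e.eval φ) : CutTree G (Fin k ⊕ Fin k) k (range φ) := by
  induction e with
  | isolated i m => exact cutTree_isolated i m φ h
  | addEdges i j hij e ih => exact ih φ h.addEdges
  | relabel i j e ih => exact ih φ h.relabel
  | merge i e ih =>
    have := ih _ h.merge
    rwa [show range (fun x => φ (Quotient.mk (e.eval.mergeSetoid i) x)) = range φ from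
      (Quotient.mk_surjective (s := e.eval.mergeSetoid i)).range_comp φ] at this
  | disjUnion e f ihe ihf =>
    have hr : range φ = range (fun x => φ (Sum.inl x)) ∪ range (fun x => φ (Sum.inr x)) :=
      range_sum φ
    have hcut := h.isCut_range e.nonempty_fin.some
    rw [hr] at hcut ⊢
    exact .union _ _ (ihe _ h.inl) (ihf _ h.inr)
      (h.ncard_inter_le Sum.inl Sum.inr (fun _ _ => Sum.inl_ne_inr)) hcut

theorem CliqueExpr.cutTree {G : SimpleGraph V} (e : CliqueExpr k) (φ : e.eval.V → V)
    (hφ : Function.Injective φ) (h : Traces G e.eval φ) : CutTree G (Fin k) 0 (range φ) := by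
  induction e with
  | vertex i =>
    have : range φ = {φ (0 : Fin 1)} := by
      ext v
      simp only [mem_range, mem_singleton_iff]
      exact ⟨fun ⟨x, hx⟩ => by rw [← hx]; exact congrArg φ (Subsingleton.elim (α := Fin 1) _ _),
        fun h => ⟨_, h.symm⟩⟩
    rw [this]
    exact .single _ (isCut_of_forall G i _ (by simp))
  | addEdges i j hij e ih => exact ih φ hφ h.addEdges
  | relabel i j e ih => exact ih φ hφ h.relabel
  | disjUnion e f ihe ihf =>
    have hr : range φ = range (fun x => φ (Sum.inl x)) ∪ range (fun x => φ (Sum.inr x)) :=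
      range_sum φ
    have hcut := h.isCut_range_of_injective hφ e.nonempty_fin.some
    rw [hr] at hcut ⊢
    refine .union _ _ (ihe _ (hφ.comp Sum.inl_injective) h.inl)
      (ihf _ (hφ.comp Sum.inr_injective) h.inr) ?_ hcut
    have : range (fun x => φ (Sum.inl x)) ∩ range (fun x => φ (Sum.inr x)) = ∅ := by
      ext v
      simp only [mem_inter_iff, mem_range, mem_empty_iff_false, iff_false]
      rintro ⟨⟨x, hx⟩, y, hy⟩
      exact Sum.inl_ne_inr (hφ (hx.trans hy.symm))
    rw [this, ncard_empty]

/-- Following one child at every union gives a chain of cuts, with increments in small sets. -/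
theorem CutTree.exists_chain {G : SimpleGraph V} {α : Type*} {q : ℕ} {M : Set V → Prop}
    (h₀ : M ∅) (h₁ : ∀ v, M {v})
    (h₂ : ∀ A B, IsCut G α A → IsCut G α B → (A ∩ B).ncard ≤ q → M A ∨ M B)
    {A : Set V} (h : CutTree G α q A) :
    ∃ (B : ℕ → Set V) (n : ℕ), Monotone B ∧ B 0 = ∅ ∧ B n = A ∧ (∀ j, IsCut G α (B j)) ∧
      ∀ j, ∃ U, M U ∧ B (j + 1) ⊆ B j ∪ U := by
  have extend : ∀ A U : Set V, M U → IsCut G α (A ∪ U) →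
      (∃ (B : ℕ → Set V) (n : ℕ), Monotone B ∧ B 0 = ∅ ∧ B n = A ∧ (∀ j, IsCut G α (B j)) ∧
        ∀ j, ∃ U, M U ∧ B (j + 1) ⊆ B j ∪ U) →
      ∃ (B : ℕ → Set V) (n : ℕ), Monotone B ∧ B 0 = ∅ ∧ B n = A ∪ U ∧ (∀ j, IsCut G α (B j)) ∧
        ∀ j, ∃ U, M U ∧ B (j + 1) ⊆ B j ∪ U := by
    rintro A U hU hc ⟨B, n, hm, hB, rfl, hcut, hstep⟩
    refine ⟨fun j => if j ≤ n then B j else B n ∪ U, n + 1, ?_, by simpa using hB, by simp, ?_, ?_⟩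
    · refine monotone_nat_of_le_succ fun j => ?_
      by_cases hj : j + 1 ≤ n
      · simpa [hj, (Nat.le_succ j).trans hj] using hm (Nat.le_succ j)
      · by_cases hj' : j ≤ n
        · simpa [hj, hj'] using (hm hj').trans subset_union_left
        · simp [hj, hj']
    · intro j
      by_cases hj : j ≤ n
      · simpa [hj] using hcut j
      · simpa [hj] using hc
    · intro j
      by_cases hj : j + 1 ≤ n
      · simpa [hj, (Nat.le_succ j).trans hj] using hstep j
      · refine ⟨U, hU, ?_⟩
        by_cases hj' : j ≤ n
        · obtain rfl : j = n := by omega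
          simp
        · simp [hj, hj']
  induction h with
  | empty h =>
    exact ⟨fun _ => ∅, 0, monotone_const, rfl, rfl, fun _ => h, fun _ => ⟨∅, h₀, by simp⟩⟩
  | single v h =>
    have := extend ∅ {v} (h₁ v) (by simpa using h) ⟨fun _ => ∅, 0, monotone_const, rfl, rfl,
      fun _ => ⟨h.choose, by simp⟩, fun _ => ⟨∅, h₀, by simp⟩⟩
    simpa using this
  | union A B hA hB hAB hc ihA ihB =>
    -- The part satisfying `M` becomes the last increment; the chain of the other part is kept.
    rcases h₂ A B hA.isCut hB.isCut hAB with h | h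
    · rw [union_comm] at hc ⊢
      exact extend B A h hc ihB
    · exact extend A B h hc ihA

end FusionWidth

/-! ### Ternary trees over stars -/

namespace FusionWidth

open Set

/-- Ternary trees of height `h` over stars with `m` leaves; the root carries label `0`. -/
def treeExpr (m : ℕ) : ℕ → FusionExpr 3
  | 0 => .addEdges 0 1 (by decide) (.disjUnion (.isolated 0 1) (.isolated 1 m))
  | h + 1 => .relabel 2 0 (.relabel 0 1 (.addEdges 0 2 (by decide)
      (.disjUnion (.isolated 2 1)
        (.disjUnion (treeExpr m h) (.disjUnion (treeExpr m h) (treeExpr m h))))))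

abbrev treeLG (m h : ℕ) : LabeledGraph 3 := (treeExpr m h).eval

abbrev Tree (m h : ℕ) : Type := (treeLG m h).V

abbrev treeGraph (m h : ℕ) : SimpleGraph (Tree m h) := (treeLG m h).graph

variable {m : ℕ}

def starCenter (m : ℕ) : Tree m 0 := (Sum.inl 0 : Fin 1 ⊕ Fin m)

def starLeaf (b : Fin m) : Tree m 0 := (Sum.inr b : Fin 1 ⊕ Fin m)

def treeRoot (m h : ℕ) : Tree m (h + 1) :=
  (Sum.inl 0 : Fin 1 ⊕ (Tree m h ⊕ (Tree m h ⊕ Tree m h)))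

/-- The three main branches of a tree. -/
def treeBranch {h : ℕ} (i : Fin 3) (x : Tree m h) : Tree m (h + 1) :=
  match i with
  | 0 => (Sum.inr (Sum.inl x) : Fin 1 ⊕ (Tree m h ⊕ (Tree m h ⊕ Tree m h)))
  | 1 => (Sum.inr (Sum.inr (Sum.inl x)) : Fin 1 ⊕ (Tree m h ⊕ (Tree m h ⊕ Tree m h)))
  | 2 => (Sum.inr (Sum.inr (Sum.inr x)) : Fin 1 ⊕ (Tree m h ⊕ (Tree m h ⊕ Tree m h)))

theorem tree_zero_cases (x : Tree m 0) : x = starCenter m ∨ ∃ b, x = starLeaf b := by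
  change Fin 1 ⊕ Fin m at x
  rcases x with x | b
  · left; rw [Subsingleton.elim x 0]; rfl
  · exact Or.inr ⟨b, rfl⟩

theorem tree_succ_cases {h : ℕ} (x : Tree m (h + 1)) :
    x = treeRoot m h ∨ ∃ i y, x = treeBranch i y := by
  change Fin 1 ⊕ (Tree m h ⊕ (Tree m h ⊕ Tree m h)) at x
  rcases x with x | x | x | x
  · left; rw [Subsingleton.elim x 0]; rfl
  · exact Or.inr ⟨0, x, rfl⟩
  · exact Or.inr ⟨1, x, rfl⟩
  · exact Or.inr ⟨2, x, rfl⟩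

theorem star_adj (b : Fin m) : (treeGraph m 0).Adj (starCenter m) (starLeaf b) := by
  refine Or.inr ((SimpleGraph.fromRel_adj _ _ _).2 ⟨Sum.inl_ne_inr, Or.inl ⟨rfl, rfl⟩⟩)

theorem treeLabel_ne_two (h : ℕ) (x : Tree m h) : (treeLG m h).label x ≠ 2 := by
  cases h with
  | zero =>
    rcases tree_zero_cases x with rfl | ⟨b, rfl⟩
    · exact (by decide : (0 : Fin 3) ≠ 2)
    · exact (by decide : (1 : Fin 3) ≠ 2)
  | succ h =>
    have key : ∀ a : Fin 3, (if (if a = 0 then 1 else a) = 2 then 0 else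
      (if a = 0 then (1 : Fin 3) else a)) ≠ 2 := by decide
    exact key _

theorem treeLabel_root (h : ℕ) : (treeLG m (h + 1)).label (treeRoot m h) = 0 := rfl

theorem treeLabel_star : (treeLG m 0).label (starCenter m) = 0 := rfl

theorem exists_treeLabel_eq_zero (m h : ℕ) : ∃ x, (treeLG m h).label x = 0 := by
  cases h with
  | zero => exact ⟨_, treeLabel_star⟩
  | succ h => exact ⟨_, treeLabel_root h⟩

/-- The disjoint union of a single vertex and three trees. -/
def branches (m h : ℕ) : LabeledGraph 3 :=
  (LabeledGraph.isolated 2 1).disjUnion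
    ((treeLG m h).disjUnion ((treeLG m h).disjUnion (treeLG m h)))

/-- Holds by definition, because adding edges and relabeling leave the vertex type unchanged. -/
theorem tree_succ_adj {h : ℕ} (x y : Tree m (h + 1)) :
    (treeGraph m (h + 1)).Adj x y ↔ (branches m h).graph.Adj x y ∨ (x ≠ y ∧
      (((branches m h).label x = 0 ∧ (branches m h).label y = 2) ∨
        ((branches m h).label y = 0 ∧ (branches m h).label x = 2))) :=
  Iff.rfl

theorem branches_label_branch {h : ℕ} (i : Fin 3) (x : Tree m h) :
    (branches m h).label (treeBranch i x) = (treeLG m h).label x := by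
  fin_cases i <;> rfl

theorem branches_adj_branch {h : ℕ} (i j : Fin 3) (x y : Tree m h) :
    (branches m h).graph.Adj (treeBranch i x) (treeBranch j y) ↔
      i = j ∧ (treeGraph m h).Adj x y := by
  fin_cases i <;> fin_cases j <;>
    first
      | exact ⟨fun h => ⟨rfl, h⟩, fun h => h.2⟩
      -- Adjacency between different summands unfolds to `false = true`.
      | exact ⟨fun h => absurd h Bool.false_ne_true, fun h => absurd h.1 (by decide)⟩

theorem treeRoot_ne_treeBranch {h : ℕ} (i : Fin 3) (x : Tree m h) :
    treeRoot m h ≠ treeBranch i x := by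
  fin_cases i <;> exact Sum.inl_ne_inr

theorem treeBranch_adj {h : ℕ} (i j : Fin 3) (x y : Tree m h) :
    (treeGraph m (h + 1)).Adj (treeBranch i x) (treeBranch j y) ↔
      i = j ∧ (treeGraph m h).Adj x y := by
  rw [tree_succ_adj, branches_label_branch, branches_label_branch, branches_adj_branch]
  simp [treeLabel_ne_two h x, treeLabel_ne_two h y]

theorem treeRoot_adj {h : ℕ} (i : Fin 3) (x : Tree m h) (hx : (treeLG m h).label x = 0) :
    (treeGraph m (h + 1)).Adj (treeRoot m h) (treeBranch i x) :=
  (tree_succ_adj _ _).2 (Or.inr ⟨treeRoot_ne_treeBranch i x,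
    Or.inr ⟨(branches_label_branch i x).trans hx, rfl⟩⟩)

theorem treeBranch_ne {h : ℕ} {i j : Fin 3} (hij : i ≠ j) (x y : Tree m h) :
    treeBranch i x ≠ treeBranch j y := by
  fin_cases i <;> fin_cases j <;> 
    first
      | exact absurd rfl hij
      | exact Sum.inr_injective.ne Sum.inl_ne_inr
      | exact Sum.inr_injective.ne Sum.inr_ne_inl
      | exact Sum.inr_injective.ne (Sum.inr_injective.ne Sum.inl_ne_inr)
      | exact Sum.inr_injective.ne (Sum.inr_injective.ne Sum.inr_ne_inl)

theorem tree_preconnected (m h : ℕ) : (treeGraph m h).Preconnected := by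
  suffices H : ∃ r, ∀ x, (treeGraph m h).Reachable r x by
    obtain ⟨r, hr⟩ := H
    exact fun x y => (hr x).symm.trans (hr y)
  induction h with
  | zero =>
    refine ⟨starCenter m, fun x => ?_⟩
    rcases tree_zero_cases x with rfl | ⟨b, rfl⟩
    · exact .refl _
    · exact (star_adj b).reachable
  | succ h ih =>
    obtain ⟨r, hr⟩ := ih
    refine ⟨treeRoot m h, fun x => ?_⟩
    rcases tree_succ_cases x with rfl | ⟨i, y, rfl⟩
    · exact .refl _
    · obtain ⟨z, hz⟩ := exists_treeLabel_eq_zero m h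
      refine (treeRoot_adj i z hz).reachable.trans ?_
      let f : treeGraph m h →g treeGraph m (h + 1) :=
        ⟨treeBranch i, fun {a b} hab => (treeBranch_adj i i a b).2 ⟨rfl, hab⟩⟩
      exact ((hr z).symm.trans (hr y)).map f

theorem exists_adj_of_preconnected {W : Type*} {H : SimpleGraph W} (hH : H.Preconnected)
    {S : Set W} {a b : W} (ha : a ∈ S) (hb : b ∉ S) : ∃ x ∈ S, ∃ y ∉ S, H.Adj x y := by
  obtain ⟨p⟩ := hH a b
  obtain ⟨d, -, h₁, h₂⟩ := p.exists_boundary_dart S ha hb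
  exact ⟨d.fst, h₁, d.snd, h₂, d.adj⟩

/-! ### Chains of cuts need many labels -/

/-- The type of a vertex of the tree: different leaves of a star have different types. -/
def treeType {β : Type} (ty : Fin m → β) (b₀ : β) : (h : ℕ) → Tree m h → β
  | 0 => Sum.elim (fun _ : Fin 1 => b₀) ty
  | h + 1 => Sum.elim (fun _ : Fin 1 => b₀) (Sum.elim (treeType ty b₀ h)
      (Sum.elim (treeType ty b₀ h) (treeType ty b₀ h)))

theorem treeType_branch {β : Type} (ty : Fin m → β) (b₀ : β) {h : ℕ} (i : Fin 3) (x : Tree m h) :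
    treeType ty b₀ (h + 1) (treeBranch i x) = treeType ty b₀ h x := by
  fin_cases i <;> rfl

variable {V : Type*} {α : Type*}

/-- The labels of the vertices of `B` that have a neighbour outside `B`, inside the set `Y`. -/
def boundaryLabels (G : SimpleGraph V) (l : V → α) (B Y : Set V) : Set α :=
  l '' {b | b ∈ B ∧ b ∈ Y ∧ ∃ o ∈ Y, o ∉ B ∧ G.Adj b o}

/-- In every chain of cuts of a ternary tree, some cut needs many labels. -/
theorem exists_lt_ncard_boundaryLabels [Finite α] {β : Type} {ty : Fin m → β}
    (hty : Function.Surjective ty)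
    {b₀ : β} {G : SimpleGraph V} {tyV : V → β} {B : ℕ → Set V} {n : ℕ} (hm : Monotone B)
    (hB₀ : B 0 = ∅) (hBn : B n = univ) {l : ℕ → V → α}
    (hl : ∀ j, ∀ x ∈ B j, ∀ y ∈ B j, l j x = l j y → ∀ z ∉ B j, (G.Adj x z ↔ G.Adj y z))
    (hstep : ∀ j, ∃ U, (∃ τ, ∀ v ∈ U, tyV v ≠ τ) ∧ B (j + 1) ⊆ B j ∪ U) (h : ℕ)
    (g : Tree m h → V) (hg : ∀ x y, G.Adj (g x) (g y) ↔ (treeGraph m h).Adj x y)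
    (hgty : ∀ x, tyV (g x) = treeType ty b₀ h x) :
    ∃ j, h < (boundaryLabels G (l j) (B j) (range g)).ncard := by
  classical
  have pair : ∀ h (g : Tree m h → V), (∀ x y, G.Adj (g x) (g y) ↔ (treeGraph m h).Adj x y) →
      ∀ j x y, g x ∈ B j → g y ∉ B j →
        ∃ x y, g x ∈ B j ∧ g y ∉ B j ∧ G.Adj (g x) (g y) := by
    intro h g hg j x y hx hy
    obtain ⟨x', hx', y', hy', ha⟩ := exists_adj_of_preconnected (tree_preconnected m h)
      (S := g ⁻¹' B j) hx hy
    exact ⟨x', y', hx', hy', (hg _ _).2 ha⟩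
  induction h with
  | zero =>
    -- Just before the star is completely swallowed, the leaf of the type missed by the increment is
    -- already inside, so the star is split and connectedness yields a boundary edge.
    have hex : ∃ j, range g ⊆ B j := ⟨n, by simp [hBn]⟩
    set j := Nat.find hex with hj
    have hj₀ : j ≠ 0 := by
      intro h0
      have := Nat.find_spec hex
      rw [← hj, h0, hB₀] at this
      exact this ⟨starCenter m, rfl⟩
    obtain ⟨i, hi⟩ := Nat.exists_eq_succ_of_ne_zero hj₀
    have h₁ : range g ⊆ B (i + 1) := by
      have := Nat.find_spec hex
      rwa [← hj, hi] at this
    have h₂ : ¬ range g ⊆ B i := Nat.find_min hex (by omega)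
    obtain ⟨_, ⟨y, rfl⟩, hy⟩ := not_subset.1 h₂
    obtain ⟨U, ⟨τ, hτ⟩, hU⟩ := hstep i
    obtain ⟨b, rfl⟩ := hty τ
    have hx : g (starLeaf b) ∈ B i := by
      rcases hU (h₁ ⟨starLeaf b, rfl⟩) with h | h
      · exact h
      · exact absurd (hgty _) (hτ _ h)
    obtain ⟨x', y', hx', hy', ha⟩ := pair 0 g hg i _ _ hx hy
    refine ⟨i, (Set.ncard_pos (toFinite _)).2 ⟨_, mem_image_of_mem _ ⟨hx', ⟨x', rfl⟩, ?_⟩⟩⟩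
    exact ⟨_, ⟨y', rfl⟩, hy', ha⟩
  | succ h ih =>
    have hbr : ∀ i x y, G.Adj (g (treeBranch i x)) (g (treeBranch i y)) ↔
        (treeGraph m h).Adj x y := by
      intro i x y
      rw [hg, treeBranch_adj]
      simp
    have hj := fun i => ih (fun x => g (treeBranch i x)) (hbr i)
      (fun x => by rw [hgty, treeType_branch])
    choose j hj using hj
    -- Sort the branches by the time of their rich cut. At the middle time `J`, branch `i₁` already
    -- meets the cut and branch `i₃` is not yet contained in it; with the root they form a connected
    -- part avoiding branch `i₂`.
    obtain ⟨i₁, i₂, i₃, h₁₂, h₂₃, hj₁, hj₃⟩ : ∃ i₁ i₂ i₃ : Fin 3, i₁ ≠ i₂ ∧ i₃ ≠ i₂ ∧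
        j i₁ ≤ j i₂ ∧ j i₂ ≤ j i₃ := by
      rcases le_total (j 0) (j 1) with h01 | h01 <;> rcases le_total (j 1) (j 2) with h12 | h12 <;>
        rcases le_total (j 0) (j 2) with h02 | h02
      · exact ⟨0, 1, 2, by decide, by decide, h01, h12⟩
      · exact ⟨0, 1, 2, by decide, by decide, h01, h12⟩
      · exact ⟨0, 2, 1, by decide, by decide, h02, h12⟩
      · exact ⟨2, 0, 1, by decide, by decide, h02, h01⟩
      · exact ⟨1, 0, 2, by decide, by decide, h01, h02⟩
      · exact ⟨1, 2, 0, by decide, by decide, h12, h02⟩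
      · exact ⟨2, 1, 0, by decide, by decide, h12, h01⟩
      · exact ⟨2, 1, 0, by decide, by decide, h12, h01⟩
    set J := j i₂ with hJ
    have hne : ∀ i, ∃ x y, g (treeBranch i x) ∈ B (j i) ∧ g (treeBranch i y) ∉ B (j i) := by
      intro i
      obtain ⟨_, _, ⟨hb, ⟨x, rfl⟩, _, ⟨y, rfl⟩, ho, -⟩, -⟩ :=
        (Set.ncard_pos (toFinite _)).1 ((Nat.zero_le h).trans_lt (hj i))
      exact ⟨x, y, hb, ho⟩
    obtain ⟨x₁, -, hx₁, -⟩ := hne i₁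
    obtain ⟨-, y₃, -, hy₃⟩ := hne i₃
    replace hx₁ := hm hj₁ hx₁
    replace hy₃ : g (treeBranch i₃ y₃) ∉ B J := fun hc => hy₃ (hm hj₃ hc)
    obtain ⟨r, hr⟩ := exists_treeLabel_eq_zero m h
    -- a boundary edge outside the middle branch
    obtain ⟨b, o, hb, ho, hbo, hb', ho'⟩ : ∃ b o, g b ∈ B J ∧ g o ∉ B J ∧ G.Adj (g b) (g o) ∧
        (∀ x, b ≠ treeBranch i₂ x) ∧ ∀ x, o ≠ treeBranch i₂ x := by
      by_cases hroot : g (treeRoot m h) ∈ B J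
      · by_cases h3 : g (treeBranch i₃ r) ∈ B J
        · obtain ⟨x, y, hx, hy, ha⟩ := pair h _ (hbr i₃) J _ _ h3 hy₃
          exact ⟨_, _, hx, hy, ha, treeBranch_ne h₂₃ _, treeBranch_ne h₂₃ _⟩
        · exact ⟨_, _, hroot, h3, (hg _ _).2 (treeRoot_adj _ _ hr), treeRoot_ne_treeBranch _,
            treeBranch_ne h₂₃ _⟩
      · by_cases h1 : g (treeBranch i₁ r) ∈ B J
        · exact ⟨_, _, h1, hroot, (hg _ _).2 (treeRoot_adj _ _ hr).symm, treeBranch_ne h₁₂ _,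
            treeRoot_ne_treeBranch _⟩
        · obtain ⟨x, y, hx, hy, ha⟩ := pair h _ (hbr i₁) J _ _ hx₁ h1
          exact ⟨_, _, hx, hy, ha, treeBranch_ne h₁₂ _, treeBranch_ne h₁₂ _⟩
    have hroot : ∀ c x, (∀ x, c ≠ treeBranch i₂ x) →
        (treeGraph m (h + 1)).Adj c (treeBranch i₂ x) → c = treeRoot m h := by
      intro c x hc ha
      rcases tree_succ_cases c with rfl | ⟨i, y, rfl⟩
      · rfl
      · obtain ⟨rfl, -⟩ := (treeBranch_adj _ _ _ _).1 ha
        exact absurd rfl (hc y)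
    refine ⟨J, ?_⟩
    -- The label of `b` is new: a boundary vertex of branch `i₂` sharing it would make both `b` and
    -- `o` adjacent to branch `i₂`, forcing both to be the root.
    have hnot : l J (g b) ∉ boundaryLabels G (l J) (B J) (range fun x => g (treeBranch i₂ x)) := by
      rintro ⟨_, ⟨hc, ⟨x, rfl⟩, _, ⟨y, rfl⟩, hy, ha⟩, hlab⟩
      have e₁ := (hg _ _).1 ((hl J _ hc _ hb hlab _ hy).1 ha)
      have e₂ := (hg _ _).1 ((hl J _ hc _ hb hlab _ ho).2 hbo)
      have := (hg _ _).1 hbo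
      rw [hroot _ _ hb' e₁, hroot _ _ ho' e₂.symm] at this
      exact this.ne rfl
    have hsub : insert (l J (g b))
        (boundaryLabels G (l J) (B J) (range fun x => g (treeBranch i₂ x))) ⊆
        boundaryLabels G (l J) (B J) (range g) := by
      apply insert_subset
      · exact mem_image_of_mem _ ⟨hb, ⟨b, rfl⟩, _, ⟨o, rfl⟩, ho, hbo⟩
      · apply image_mono
        rintro _ ⟨hc, ⟨x, rfl⟩, _, ⟨y, rfl⟩, hy, ha⟩
        exact ⟨hc, ⟨_, rfl⟩, _, ⟨_, rfl⟩, hy, ha⟩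
    have h1 := Set.ncard_le_ncard hsub (toFinite _)
    rw [Set.ncard_insert_of_notMem hnot (toFinite _)] at h1
    have := hj i₂
    rw [← hJ] at this
    omega

end FusionWidth

/-! ### Adding a vertex with one additional label -/

namespace FusionWidth

open Set

variable {k : ℕ}

/-- `A'` is `A` together with copies of a new vertex, labeled by the additional label, such that
exactly the vertices in `Q` have a neighbour among the copies. -/
def Augments (A : LabeledGraph k) (Q : A.V → Prop) (A' : LabeledGraph (k + 1)) : Prop :=
  ∃ g : A.V → A'.V, Function.Injective g ∧
    (∀ x, A'.label (g x) = (A.label x).castSucc) ∧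
    (∀ y, A'.label y = Fin.last k ∨ ∃ x, g x = y) ∧
    (∀ x y, A'.graph.Adj (g x) (g y) ↔ A.graph.Adj x y) ∧
    (∀ y z, A'.label y = Fin.last k → A'.label z = Fin.last k → ¬ A'.graph.Adj y z) ∧
    (∀ x, (∃ y, A'.label y = Fin.last k ∧ A'.graph.Adj (g x) y) ↔ Q x) ∧
    ∃ y, A'.label y = Fin.last k

namespace LabeledGraph

theorem addEdges_adj (A : LabeledGraph k) (i j : Fin k) (x y : A.V) :
    (A.addEdges i j).graph.Adj x y ↔ A.graph.Adj x y ∨ (x ≠ y ∧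
      ((A.label x = i ∧ A.label y = j) ∨ (A.label y = i ∧ A.label x = j))) :=
  Iff.rfl

theorem merge_mk_eq_iff (A : LabeledGraph k) (i : Fin k) (x y : A.V) :
    Quotient.mk (A.mergeSetoid i) x = Quotient.mk (A.mergeSetoid i) y ↔
      x = y ∨ (A.label x = i ∧ A.label y = i) :=
  Quotient.eq (r := A.mergeSetoid i)

theorem merge_adj (A : LabeledGraph k) (i : Fin k) (a b : (A.merge i).V) :
    (A.merge i).graph.Adj a b ↔ a ≠ b ∧ ∃ x y : A.V, Quotient.mk (A.mergeSetoid i) x = a ∧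
      Quotient.mk (A.mergeSetoid i) y = b ∧ A.graph.Adj x y := by
  refine (SimpleGraph.fromRel_adj _ _ _).trans (and_congr Iff.rfl ⟨?_, Or.inl⟩)
  rintro (h | ⟨x, y, hx, hy, h⟩)
  · exact h
  · exact ⟨y, x, hy, hx, h.symm⟩

theorem not_disjUnion_adj_inl_inr (A B : LabeledGraph k) (x : A.V) (y : B.V) :
    ¬ (A.disjUnion B).graph.Adj (Sum.inl x) (Sum.inr y) := Bool.false_ne_true

theorem not_disjUnion_adj_inr_inl (A B : LabeledGraph k) (x : A.V) (y : B.V) :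
    ¬ (A.disjUnion B).graph.Adj (Sum.inr y) (Sum.inl x) := Bool.false_ne_true

end LabeledGraph

open LabeledGraph

namespace Augments

variable {A B : LabeledGraph k} {A' B' : LabeledGraph (k + 1)}

theorem addEdges {Q : A.V → Prop} (h : Augments A Q A') (i j : Fin k) :
    Augments (A.addEdges i j) Q (A'.addEdges i.castSucc j.castSucc) := by
  obtain ⟨g, hinj, hlab, hcov, hadj, hlast, hQ, hne⟩ := h
  refine ⟨g, hinj, hlab, hcov, ?_, ?_, ?_, hne⟩
  · have hl : ∀ x l, A'.label (g x) = l.castSucc ↔ A.label x = l := by simp [hlab]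
    exact fun x y => or_congr (hadj x y) (and_congr hinj.ne_iff
      (or_congr (and_congr (hl x i) (hl y j)) (and_congr (hl y i) (hl x j))))
  · intro y z (hy : A'.label y = _) (hz : A'.label z = _) h
    rcases (addEdges_adj _ _ _ _ _).1 h with h | ⟨-, h | h⟩
    · exact hlast y z hy hz h
    · exact absurd (h.1.symm.trans hy) (Fin.castSucc_lt_last i).ne
    · exact absurd (h.1.symm.trans hz) (Fin.castSucc_lt_last i).ne
  · intro x
    refine Iff.trans ⟨?_, ?_⟩ (hQ x)
    · rintro ⟨y, hy, h⟩
      replace hy : A'.label y = _ := hy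
      refine ⟨y, hy, ?_⟩
      rcases (addEdges_adj _ _ _ _ _).1 h with h | ⟨-, h | h⟩
      · exact h
      · exact absurd (h.2.symm.trans hy) (Fin.castSucc_lt_last j).ne
      · exact absurd (h.1.symm.trans hy) (Fin.castSucc_lt_last i).ne
    · rintro ⟨y, hy, h⟩
      exact ⟨y, hy, (addEdges_adj _ _ _ _ _).2 (Or.inl h)⟩

theorem relabel {Q : A.V → Prop} (h : Augments A Q A') (i j : Fin k) :
    Augments (A.relabel i j) Q (A'.relabel i.castSucc j.castSucc) := by
  obtain ⟨g, hinj, hlab, hcov, hadj, hlast, hQ, hne⟩ := h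
  have key : ∀ y, (A'.relabel i.castSucc j.castSucc).label y = Fin.last k ↔
      A'.label y = Fin.last k := by
    intro y
    change (if A'.label y = i.castSucc then j.castSucc else A'.label y) = Fin.last k ↔ _
    split_ifs with h
    · simp [h, (Fin.castSucc_lt_last _).ne]
    · rfl
  refine ⟨g, hinj, ?_, fun y => (hcov y).imp_left (key y).2, hadj,
    fun y z hy hz => hlast y z ((key y).1 hy) ((key z).1 hz),
    fun x => Iff.trans (exists_congr fun y => and_congr (key y) Iff.rfl) (hQ x),
    hne.imp fun y => (key y).2⟩
  have h : ∀ x : A.V, (if A'.label (g x) = i.castSucc then j.castSucc else A'.label (g x)) =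
      (if A.label x = i then j else A.label x).castSucc := by
    intro x
    rw [hlab]
    simp only [Fin.castSucc_inj]
    split_ifs <;> rfl
  exact h

theorem disjUnion {Q : (A.disjUnion B).V → Prop}
    (hA : Augments A (fun x => Q (Sum.inl x)) A') (hB : Augments B (fun x => Q (Sum.inr x)) B') :
    Augments (A.disjUnion B) Q (A'.disjUnion B') := by
  obtain ⟨g, hinj, hlab, hcov, hadj, hlast, hQ, ⟨y₀, hy₀⟩⟩ := hA
  obtain ⟨g', hinj', hlab', hcov', hadj', hlast', hQ', -⟩ := hB
  refine ⟨Sum.map g g', hinj.sumMap hinj', ?_, ?_, ?_, ?_, ?_, ⟨Sum.inl y₀, hy₀⟩⟩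
  · rintro (x | x)
    · exact hlab x
    · exact hlab' x
  · rintro (y | y)
    · exact (hcov y).imp_right fun ⟨x, hx⟩ => ⟨Sum.inl x, congrArg Sum.inl hx⟩
    · exact (hcov' y).imp_right fun ⟨x, hx⟩ => ⟨Sum.inr x, congrArg Sum.inr hx⟩
  · rintro (x | x) (y | y)
    · exact hadj x y
    · exact Iff.rfl
    · exact Iff.rfl
    · exact hadj' x y
  · rintro (y | y) (z | z) hy hz
    · exact hlast y z hy hz
    · exact not_disjUnion_adj_inl_inr _ _ _ _
    · exact not_disjUnion_adj_inr_inl _ _ _ _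
    · exact hlast' y z hy hz
  · rintro (x | x)
    · refine Iff.trans ⟨?_, ?_⟩ (hQ x)
      · rintro ⟨y | y, hy, h⟩
        · exact ⟨y, hy, h⟩
        · exact absurd h (not_disjUnion_adj_inl_inr _ _ _ _)
      · rintro ⟨y, hy, h⟩
        exact ⟨Sum.inl y, hy, h⟩
    · refine Iff.trans ⟨?_, ?_⟩ (hQ' x)
      · rintro ⟨y | y, hy, h⟩
        · exact absurd h (not_disjUnion_adj_inr_inl _ _ _ _)
        · exact ⟨y, hy, h⟩
      · rintro ⟨y, hy, h⟩
        exact ⟨Sum.inr y, hy, h⟩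

/-- `Q` is pulled back, so fused vertices agree on it. The copies do not carry the merged label and
stay distinct. -/
theorem merge {i : Fin k} {Q : (A.merge i).V → Prop}
    (h : Augments A (fun x => Q (Quotient.mk (A.mergeSetoid i) x)) A') :
    Augments (A.merge i) Q (A'.merge i.castSucc) := by
  obtain ⟨g, hinj, hlab, hcov, hadj, hlast, hQ, y₀, hy₀⟩ := h
  have hmk : ∀ x y, Quotient.mk (A'.mergeSetoid i.castSucc) (g x) =
      Quotient.mk (A'.mergeSetoid i.castSucc) (g y) ↔
      Quotient.mk (A.mergeSetoid i) x = Quotient.mk (A.mergeSetoid i) y := by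
    intro x y
    rw [merge_mk_eq_iff, merge_mk_eq_iff, hlab, hlab]
    simp [hinj.eq_iff]
  have hmkl : ∀ y z, A'.label y = Fin.last k → (Quotient.mk (A'.mergeSetoid i.castSucc) z =
      Quotient.mk (A'.mergeSetoid i.castSucc) y ↔ z = y) := by
    intro y z hy
    rw [merge_mk_eq_iff, hy]
    simp [(Fin.castSucc_lt_last i).ne']
  refine ⟨Quotient.lift (fun x => Quotient.mk (A'.mergeSetoid i.castSucc) (g x))
    (fun x y hxy => (hmk x y).2 (Quotient.sound hxy)), ?_, ?_, ?_, ?_, ?_, ?_,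
    ⟨Quotient.mk _ y₀, hy₀⟩⟩
  · rintro ⟨x⟩ ⟨y⟩ h
    exact (hmk x y).1 h
  · rintro ⟨x⟩
    exact hlab x
  · rintro ⟨y⟩
    rcases hcov y with h | ⟨x, rfl⟩
    · exact Or.inl h
    · exact Or.inr ⟨Quotient.mk _ x, rfl⟩
  · rintro ⟨x⟩ ⟨y⟩
    refine (merge_adj _ _ _ _).trans (Iff.trans (and_congr (not_congr (hmk x y)) ?_)
      (merge_adj _ _ _ _).symm)
    constructor
    · rintro ⟨x', y', hx, hy, h⟩
      have lift : ∀ z z', Quotient.mk (A'.mergeSetoid i.castSucc) z' =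
          Quotient.mk (A'.mergeSetoid i.castSucc) (g z) →
          ∃ w, g w = z' ∧ Quotient.mk (A.mergeSetoid i) w = Quotient.mk (A.mergeSetoid i) z := by
        intro z z' hz
        rcases hcov z' with h | ⟨w, rfl⟩
        · exact ⟨z, ((hmkl z' (g z) h).1 hz.symm), rfl⟩
        · exact ⟨w, rfl, (hmk _ _).1 hz⟩
      obtain ⟨w, rfl, hw⟩ := lift x x' hx
      obtain ⟨w', rfl, hw'⟩ := lift y y' hy
      exact ⟨w, w', hw, hw', (hadj _ _).1 h⟩
    · rintro ⟨x', y', hx, hy, h⟩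
      exact ⟨g x', g y', (hmk _ _).2 hx, (hmk _ _).2 hy, (hadj _ _).2 h⟩
  · rintro ⟨y⟩ ⟨z⟩ hy hz h
    replace hy : A'.label y = _ := hy
    replace hz : A'.label z = _ := hz
    obtain ⟨-, y', z', hy', hz', h⟩ := (merge_adj _ _ _ _).1 h
    rw [(hmkl y y' hy).1 hy', (hmkl z z' hz).1 hz'] at h
    exact hlast y z hy hz h
  · rintro ⟨x⟩
    constructor
    · rintro ⟨⟨y⟩, hy, h⟩
      replace hy : A'.label y = _ := hy
      obtain ⟨-, x', y', hx', hy', h⟩ := (merge_adj _ _ _ _).1 h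
      rw [(hmkl y y' hy).1 hy'] at h
      rcases hcov x' with hl | ⟨w, rfl⟩
      · exact absurd h (hlast _ _ hl hy)
      · have := (hQ w).1 ⟨y, hy, h⟩
        exact (congrArg Q ((hmk w x).1 hx')).mp this
    · intro hx
      obtain ⟨y, hy, h⟩ := (hQ x).2 hx
      refine ⟨Quotient.mk _ y, hy, (merge_adj _ _ _ _).2 ⟨?_, g x, y, rfl, rfl, h⟩⟩
      intro he
      exact h.ne ((hmkl y (g x) hy).1 he)

end Augments

/-- Vertices of one atom share a label but may differ on `Q`, so each is created separately and
joined to its own copy, or not, before the disjoint union. -/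
theorem exists_augments_isolated (i : Fin k) (m : ℕ) (Q : Fin m → Prop) :
    ∃ e : FusionExpr (k + 1), Augments (LabeledGraph.isolated i m) Q e.eval := by
  induction m with
  | zero =>
    -- Even an empty atom receives one copy, so that the final merge always produces the new vertex.
    refine ⟨.isolated (Fin.last k) 1, fun x => Fin.elim0 x, fun x => Fin.elim0 x,
      fun x => Fin.elim0 x, fun y => Or.inl rfl, fun x => Fin.elim0 x, fun y z _ _ h => h.elim,
      fun x => Fin.elim0 x, ⟨(0 : Fin 1), rfl⟩⟩
  | succ m ih =>
    -- the last vertex, together with a copy of the new vertex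
    have one : ∃ e : FusionExpr (k + 1),
        Augments (LabeledGraph.isolated i 1) (fun _ => Q (Fin.last m)) e.eval := by
      by_cases hQ : Q (Fin.last m)
      · refine ⟨.addEdges i.castSucc (Fin.last k) (Fin.castSucc_lt_last i).ne
          (.disjUnion (.isolated i.castSucc 1) (.isolated (Fin.last k) 1)), Sum.inl,
          Sum.inl_injective, fun _ => rfl, ?_, ?_, ?_, ?_, ⟨Sum.inr (0 : Fin 1), rfl⟩⟩
        · rintro (y | y)
          · exact Or.inr ⟨y, rfl⟩
          · exact Or.inl rfl
        · intro x y
          rw [Subsingleton.elim (α := Fin 1) x y]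
          exact iff_of_false (SimpleGraph.irrefl _) (SimpleGraph.irrefl _)
        · rintro (y | y) (z | z) hy hz
          · exact absurd hy (Fin.castSucc_lt_last i).ne
          · exact absurd hy (Fin.castSucc_lt_last i).ne
          · exact absurd hz (Fin.castSucc_lt_last i).ne
          · rw [Subsingleton.elim (α := Fin 1) y z]
            exact SimpleGraph.irrefl _
        · intro x
          refine iff_of_true ⟨Sum.inr (0 : Fin 1), rfl, ?_⟩ hQ
          exact (addEdges_adj _ _ _ _ _).2 (Or.inr ⟨Sum.inl_ne_inr, Or.inl ⟨rfl, rfl⟩⟩)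
      · refine ⟨.disjUnion (.isolated i.castSucc 1) (.isolated (Fin.last k) 1), Sum.inl,
          Sum.inl_injective, fun _ => rfl, ?_, ?_, ?_, ?_, ⟨Sum.inr (0 : Fin 1), rfl⟩⟩
        · rintro (y | y)
          · exact Or.inr ⟨y, rfl⟩
          · exact Or.inl rfl
        · intro x y
          rw [Subsingleton.elim (α := Fin 1) x y]
          exact iff_of_false (SimpleGraph.irrefl _) (SimpleGraph.irrefl _)
        · rintro (y | y) (z | z) hy hz
          · exact absurd hy (Fin.castSucc_lt_last i).ne
          · exact absurd hy (Fin.castSucc_lt_last i).ne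
          · exact absurd hz (Fin.castSucc_lt_last i).ne
          · rw [Subsingleton.elim (α := Fin 1) y z]
            exact SimpleGraph.irrefl _
        · intro x
          refine iff_of_false ?_ hQ
          rintro ⟨y | y, hy, h⟩
          · exact absurd hy (Fin.castSucc_lt_last i).ne
          · exact not_disjUnion_adj_inl_inr _ _ _ _ h
    obtain ⟨e₁, h₁⟩ := ih fun x => Q x.castSucc
    obtain ⟨e₂, h₂⟩ := one
    refine ⟨.disjUnion e₁ e₂, ?_⟩
    have h : Augments ((isolated i m).disjUnion (isolated i 1))
        (Sum.elim (fun x : Fin m => Q x.castSucc) (fun _ : Fin 1 => Q (Fin.last m)))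
        (e₁.eval.disjUnion e₂.eval) := Augments.disjUnion h₁ h₂
    obtain ⟨g, hinj, hlab, hcov, hadj, hlast, hQ, hne⟩ := h
    let f : Fin (m + 1) → Fin m ⊕ Fin 1 := finSumFinEquiv.symm
    refine ⟨fun x => g (f x), hinj.comp finSumFinEquiv.symm.injective, ?_, ?_, ?_, hlast, ?_, hne⟩
    · intro x
      refine (hlab _).trans ?_
      cases f x <;> rfl
    · intro y
      refine (hcov y).imp_right fun ⟨x, hx⟩ => ⟨finSumFinEquiv (show Fin m ⊕ Fin 1 from x), ?_⟩
      exact (congrArg g (finSumFinEquiv.symm_apply_apply (show Fin m ⊕ Fin 1 from x))).trans hx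
    · intro x y
      refine (hadj _ _).trans ?_
      refine iff_of_false ?_ (fun h => h)
      cases f x <;> cases f y
      · exact fun h => h
      · exact not_disjUnion_adj_inl_inr _ _ _ _
      · exact not_disjUnion_adj_inr_inl _ _ _ _
      · exact fun h => h
    · intro x
      refine (hQ _).trans ?_
      induction x using Fin.lastCases with
      | last =>
        have : f (Fin.last m) = Sum.inr 0 := finSumFinEquiv_symm_last
        rw [this]; rfl
      | cast x =>
        have : f x.castSucc = Sum.inl x := finSumFinEquiv_symm_apply_castSucc x
        rw [this]; rfl

theorem exists_augments (e : FusionExpr k) (Q : e.eval.V → Prop) :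
    ∃ e' : FusionExpr (k + 1), Augments e.eval Q e'.eval := by
  induction e with
  | isolated i m => exact exists_augments_isolated i m Q
  | addEdges i j hij e ih =>
    obtain ⟨e', h⟩ := ih Q
    exact ⟨.addEdges i.castSucc j.castSucc (by simpa using hij) e', h.addEdges i j⟩
  | relabel i j e ih =>
    obtain ⟨e', h⟩ := ih Q
    exact ⟨.relabel i.castSucc j.castSucc e', h.relabel i j⟩
  | merge i e ih =>
    obtain ⟨e', h⟩ := ih fun x => Q (Quotient.mk (e.eval.mergeSetoid i) x)
    exact ⟨.merge i.castSucc e', h.merge⟩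
  | disjUnion e f ihe ihf =>
    obtain ⟨e', he⟩ := ihe fun x => Q (Sum.inl x)
    obtain ⟨f', hf⟩ := ihf fun x => Q (Sum.inr x)
    exact ⟨.disjUnion e' f', he.disjUnion hf⟩

/-- Adding a vertex costs at most one additional label. -/
theorem exists_fusionExpr_of_add_vertex {V W : Type*} {H : SimpleGraph V} {G : SimpleGraph W}
    (f : H ↪g G) (v : W) (hv : ∀ x, f x ≠ v) (hf : ∀ w, w = v ∨ ∃ x, f x = w)
    (h : ∃ e : FusionExpr k, Nonempty (e.eval.graph ≃g H)) :
    ∃ e : FusionExpr (k + 1), Nonempty (e.eval.graph ≃g G) := by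
  classical
  obtain ⟨e, ⟨φ⟩⟩ := h
  obtain ⟨e', g, hinj, hlab, hcov, hadj, hlast, hQ, y₀, hy₀⟩ :=
    exists_augments e fun x => G.Adj (f (φ x)) v
  refine ⟨.merge (Fin.last k) e', ⟨?_⟩⟩
  have hgl : ∀ x, e'.eval.label (g x) ≠ Fin.last k := fun x => by
    rw [hlab]; exact (Fin.castSucc_lt_last _).ne
  have hmkg : ∀ x z, Quotient.mk (e'.eval.mergeSetoid (Fin.last k)) z =
      Quotient.mk (e'.eval.mergeSetoid (Fin.last k)) (g x) ↔ z = g x := by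
    intro x z
    rw [merge_mk_eq_iff]
    simp [hgl]
  have hmkl : ∀ y z, e'.eval.label y = Fin.last k →
      (Quotient.mk (e'.eval.mergeSetoid (Fin.last k)) z =
      Quotient.mk (e'.eval.mergeSetoid (Fin.last k)) y ↔ e'.eval.label z = Fin.last k) := by
    intro y z hy
    rw [merge_mk_eq_iff]
    constructor
    · rintro (rfl | h)
      · exact hy
      · exact h.1
    · exact fun h => Or.inr ⟨h, hy⟩
  let F : (e'.eval.merge (Fin.last k)).V → W := Quotient.lift
    (fun y => if h : ∃ x, g x = y then f (φ h.choose) else v) (by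
      rintro y z (rfl | ⟨hy, hz⟩)
      · rfl
      · rw [dif_neg, dif_neg]
        · rintro ⟨x, rfl⟩; exact hgl x hz
        · rintro ⟨x, rfl⟩; exact hgl x hy)
  have Fg : ∀ x, F (Quotient.mk _ (g x)) = f (φ x) := by
    intro x
    have h : ∃ x', g x' = g x := ⟨x, rfl⟩
    change (if h : ∃ x', g x' = g x then f (φ h.choose) else v) = _
    rw [dif_pos h, hinj h.choose_spec]
  have Fl : ∀ y, e'.eval.label y = Fin.last k → F (Quotient.mk _ y) = v := by
    intro y hy
    change (if h : ∃ x', g x' = y then f (φ h.choose) else v) = _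
    rw [dif_neg]
    rintro ⟨x, rfl⟩; exact hgl x hy
  have Finj : Function.Injective F := by
    rintro ⟨y⟩ ⟨z⟩ h
    replace h : F (Quotient.mk _ y) = F (Quotient.mk _ z) := h
    change Quotient.mk (e'.eval.mergeSetoid (Fin.last k)) y =
      Quotient.mk (e'.eval.mergeSetoid (Fin.last k)) z
    rcases hcov y with hy | ⟨x, rfl⟩ <;> rcases hcov z with hz | ⟨x', rfl⟩
    · exact (hmkl z y hz).2 hy
    · rw [Fl y hy, Fg] at h
      exact absurd h.symm (hv _)
    · rw [Fl z hz, Fg] at h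
      exact absurd h (hv _)
    · rw [Fg, Fg] at h
      rw [φ.injective (f.injective h)]
  have Fsurj : Function.Surjective F := by
    intro w
    rcases hf w with rfl | ⟨x, rfl⟩
    · exact ⟨_, Fl y₀ hy₀⟩
    · obtain ⟨x, rfl⟩ := φ.surjective x
      exact ⟨_, Fg x⟩
  have cross : ∀ x y, e'.eval.label y = Fin.last k →
      ((e'.eval.merge (Fin.last k)).graph.Adj (Quotient.mk _ (g x)) (Quotient.mk _ y) ↔
        G.Adj (f (φ x)) v) := by
    intro x y hy
    refine (merge_adj _ _ _ _).trans (Iff.trans ⟨?_, ?_⟩ (hQ x))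
    · rintro ⟨-, x', y', hx', hy', h⟩
      rw [(hmkg x x').1 hx'] at h
      exact ⟨y', (hmkl y y' hy).1 hy', h⟩
    · rintro ⟨y', hy', h⟩
      refine ⟨fun he => hgl x ((hmkl y _ hy).1 he), g x, y', rfl, (hmkl y y' hy).2 hy', h⟩
  refine ⟨Equiv.ofBijective F ⟨Finj, Fsurj⟩, ?_⟩
  rintro ⟨y⟩ ⟨z⟩
  change G.Adj (F (Quotient.mk _ y)) (F (Quotient.mk _ z)) ↔
    (e'.eval.merge (Fin.last k)).graph.Adj (Quotient.mk _ y) (Quotient.mk _ z)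
  rcases hcov y with hy | ⟨x, rfl⟩ <;> rcases hcov z with hz | ⟨x', rfl⟩
  · rw [Fl y hy, Fl z hz]
    refine iff_of_false (SimpleGraph.irrefl _) fun h => ?_
    obtain ⟨hne, -⟩ := (merge_adj _ _ _ _).1 h
    exact hne ((hmkl z y hz).2 hy)
  · rw [Fl y hy, Fg]
    exact (G.adj_comm _ _).trans ((cross x' y hy).symm.trans (SimpleGraph.adj_comm _ _ _))
  · rw [Fl z hz, Fg]
    exact (cross x z hz).symm
  · rw [Fg, Fg, f.map_rel_iff, φ.map_rel_iff, ← hadj]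
    refine Iff.trans ?_ (merge_adj _ _ _ _).symm
    constructor
    · intro h
      exact ⟨fun he => h.ne ((hmkg _ _).1 he), _, _, rfl, rfl, h⟩
    · rintro ⟨-, a, b, ha, hb, h⟩
      rwa [(hmkg _ _).1 ha, (hmkg _ _).1 hb] at h

end FusionWidth

/-! ### The tree with apex vertices and its lower bounds -/

namespace FusionWidth

open Set LabeledGraph

/-- The possible neighbourhoods of a leaf among the apex vertices, as functions on `Fin P`. -/
abbrev LeafType (P : ℕ) : Type := Fin P → Bool

/-- An enumeration of all leaf types. -/
noncomputable def leafType (P : ℕ) : Fin (Fintype.card (LeafType P)) ≃ LeafType P :=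
  (Fintype.equivFin (LeafType P)).symm

/-- The tree of height `h` with leaves of all types in `LeafType P`, together with `p` apex
vertices. -/
abbrev ApexVertex (P h p : ℕ) : Type := Fin p ⊕ Tree (Fintype.card (LeafType P)) h

noncomputable def apexType (P h p : ℕ) : ApexVertex P h p → LeafType P :=
  Sum.elim (fun _ _ => false) (treeType (leafType P) (fun _ => false) h)

/-- `P` fixes the tree independently of `p`, so raising `p` adds just one vertex; the guard `s < P`
makes surplus apices isolated. -/
noncomputable def apexAdj (P h p : ℕ) : ApexVertex P h p → ApexVertex P h p → Prop
  | .inl _, .inl _ => False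
  | .inl s, .inr x => ∃ hs : (s : ℕ) < P, treeType (leafType P) (fun _ => false) h x ⟨s, hs⟩ = true
  | .inr x, .inl s => ∃ hs : (s : ℕ) < P, treeType (leafType P) (fun _ => false) h x ⟨s, hs⟩ = true
  | .inr x, .inr y => (treeGraph _ h).Adj x y

/-- The leaf of type `τ` in each star is adjacent to the apex `s` if `τ s` is true. -/
noncomputable def apexGraph (P h p : ℕ) : SimpleGraph (ApexVertex P h p) where
  Adj := apexAdj P h p
  symm := ⟨by
    rintro (s | x) (t | y) hxy
    · exact hxy
    · exact hxy
    · exact hxy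
    · exact (treeGraph _ h).adj_symm hxy⟩
  loopless := ⟨by
    rintro (s | x) hx
    · exact hx
    · exact (treeGraph _ h).irrefl hx⟩

theorem apexGraph_adj_inl {P h p : ℕ} (hp : p ≤ P) (v : ApexVertex P h p) (s : Fin p) :
    (apexGraph P h p).Adj v (Sum.inl s) ↔ apexType P h p v (s.castLE hp) = true := by
  rcases v with t | x
  · exact iff_of_false (fun h => h) Bool.false_ne_true
  · exact ⟨fun ⟨_, h⟩ => h, fun h => ⟨_, h⟩⟩

instance FusionExpr.finite_eval {k : ℕ} (e : FusionExpr k) : Finite e.eval.V := by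
  induction e with
  | isolated i m => exact inferInstanceAs (Finite (Fin m))
  | addEdges i j hij e ih => exact ih
  | relabel i j e ih => exact ih
  | merge i e ih => exact inferInstanceAs (Finite (Quotient (e.eval.mergeSetoid i)))
  | disjUnion e f ihe ihf => exact inferInstanceAs (Finite (e.eval.V ⊕ f.eval.V))

/-- Apices outside `U` distinguish types: if every type occurred in `U`, the `2 ^ D.card` patterns
on `D` would need distinct labels. -/
theorem exists_missing_type {P h p : ℕ} (hp : p ≤ P) {α : Type} [Fintype α]
    {U : Set (ApexVertex P h p)} (hU : IsCut (apexGraph P h p) α U) (D : Finset (Fin p))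
    (hD : ∀ s ∈ D, Sum.inl s ∉ U) (hα : Fintype.card α < 2 ^ D.card) :
    ∃ τ, ∀ v ∈ U, apexType P h p v ≠ τ := by
  classical
  by_contra! hc
  obtain ⟨l, hl⟩ := hU
  choose v hv hvt using hc
  let extendType : (D → Bool) → LeafType P := fun σ t =>
    if ht : ∃ s : D, s.1.castLE hp = t then σ ht.choose else false
  have hext : ∀ σ (s : D), extendType σ (s.1.castLE hp) = σ s := by
    intro σ s
    have ht : ∃ s' : D, s'.1.castLE hp = s.1.castLE hp := ⟨s, rfl⟩
    have : ht.choose = s := Subtype.ext (Fin.castLE_injective hp ht.choose_spec)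
    simp only [extendType, dif_pos ht, this]
  have hinj : Function.Injective fun σ => l (v (extendType σ)) := by
    intro σ σ' h
    funext s
    have := hl _ (hv (extendType σ)) _ (hv (extendType σ')) h (Sum.inl s.1) (hD _ s.2)
    rw [apexGraph_adj_inl hp, apexGraph_adj_inl hp, hvt, hvt, hext, hext] at this
    exact Bool.eq_iff_iff.2 this
  have := Fintype.card_le_of_injective _ hinj
  simp at this
  omega

/-- Few labels are not enough for a decomposition of the graph by cuts. -/
theorem not_cutTree_apexGraph {P h p q : ℕ} (hp : p ≤ P) {α : Type} [Fintype α] [Nonempty α]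
    (hα : Fintype.card α < 2 ^ ((p - q) / 2)) (hh : Fintype.card α ≤ h) :
    ¬ CutTree (apexGraph P h p) α q univ := by
  classical
  intro hT
  have hP : 0 < P := by
    by_contra h0
    have : (p - q) / 2 = 0 := by omega
    rw [this] at hα
    have := Fintype.card_pos (α := α)
    omega
  have h₂ : ∀ A B : Set (ApexVertex P h p), IsCut (apexGraph P h p) α A →
      IsCut (apexGraph P h p) α B → (A ∩ B).ncard ≤ q →
      (∃ τ, ∀ v ∈ A, apexType P h p v ≠ τ) ∨ ∃ τ, ∀ v ∈ B, apexType P h p v ≠ τ := by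
    intro A B hA hB hAB
    let S : Set (ApexVertex P h p) → Finset (Fin p) := fun A =>
      Finset.univ.filter fun s => Sum.inl s ∈ A
    have hS : ∀ A, (S A)ᶜ.card = p - (S A).card := fun A => by
      rw [Finset.card_compl, Fintype.card_fin]
    have hSp : ∀ A, (S A).card ≤ p := fun A => (Finset.card_le_univ _).trans_eq (Fintype.card_fin p)
    have hI : (S A ∩ S B).card ≤ q := by
      refine le_trans ?_ hAB
      rw [← Set.ncard_coe_finset]
      refine Set.ncard_le_ncard_of_injOn Sum.inl ?_ (Sum.inl_injective.injOn) (toFinite _)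
      intro s hs
      simpa [S] using hs
    have hun : (S A ∪ S B).card ≤ p := (Finset.card_le_univ _).trans_eq (Fintype.card_fin p)
    have := Finset.card_union_add_card_inter (S A) (S B)
    have hA' := hS A
    have hB' := hS B
    have := hSp A
    have := hSp B
    -- The two apex sets have total size at most `p + q`, so their complements have total size at
    -- least `p - q`.
    have hlarge : (p - q) / 2 ≤ (S A)ᶜ.card ∨ (p - q) / 2 ≤ (S B)ᶜ.card := by omega
    rcases hlarge with h | h
    · exact Or.inl (exists_missing_type hp hA _ (by simp [S])
        (hα.trans_le (Nat.pow_le_pow_right (by norm_num) h)))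
    · exact Or.inr (exists_missing_type hp hB _ (by simp [S])
        (hα.trans_le (Nat.pow_le_pow_right (by norm_num) h)))
  obtain ⟨B, n, hm, hB₀, hBn, hcut, hstep⟩ := hT.exists_chain
    (M := fun U => ∃ τ, ∀ v ∈ U, apexType P h p v ≠ τ) ⟨fun _ => false, by simp⟩
    -- A single vertex misses the complement of its own type, which differs from it because `0 < P`.
    (fun v => ⟨fun s => !apexType P h p v s, by
      rintro _ rfl he
      simpa using congrFun he ⟨0, hP⟩⟩) h₂
  choose l hl using hcut
  obtain ⟨j, hj⟩ := exists_lt_ncard_boundaryLabels (leafType P).surjective hm hB₀ hBn hl hstep h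
    Sum.inr (fun x y => Iff.rfl) (b₀ := fun _ => false) (fun x => rfl)
  have := Set.ncard_le_card (boundaryLabels (apexGraph P h p) (l j) (B j) (range Sum.inr))
  rw [Nat.card_eq_fintype_card] at this
  omega

theorem not_exists_cliqueExpr_apexGraph {P h p c : ℕ} (hp : p ≤ P) (hc : c < 2 ^ (p / 2))
    (hh : c ≤ h) : ¬ ∃ e : CliqueExpr c, Nonempty (e.eval.graph ≃g apexGraph P h p) := by
  rintro ⟨e, ⟨φ⟩⟩
  have := e.nonempty_fin
  have hT := e.cutTree φ φ.injective (Traces.of_iso φ)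
  rw [φ.surjective.range_eq] at hT
  exact not_cutTree_apexGraph hp (by simpa using hc) (by simpa using hh) hT

theorem not_exists_fusionExpr_apexGraph {P h p c : ℕ} (hp : p ≤ P)
    (hc : 2 * c < 2 ^ ((p - c) / 2)) (hh : 2 * c ≤ h) :
    ¬ ∃ e : FusionExpr c, Nonempty (e.eval.graph ≃g apexGraph P h p) := by
  rintro ⟨e, ⟨φ⟩⟩
  have := e.nonempty_fin
  have hT := e.cutTree φ (Traces.of_iso φ)
  rw [φ.surjective.range_eq] at hT
  refine not_cutTree_apexGraph hp ?_ ?_ hT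
  · simpa [← two_mul] using hc
  · simpa [← two_mul] using hh

theorem exists_fusionExpr_apexGraph_succ {P h p k : ℕ}
    (he : ∃ e : FusionExpr k, Nonempty (e.eval.graph ≃g apexGraph P h p)) :
    ∃ e : FusionExpr (k + 1), Nonempty (e.eval.graph ≃g apexGraph P h (p + 1)) := by
  let f : apexGraph P h p ↪g apexGraph P h (p + 1) :=
    ⟨⟨Sum.map Fin.castSucc id, (Fin.castSucc_injective p).sumMap Function.injective_id⟩, by
      rintro (s | x) (t | y) <;> exact Iff.rfl⟩
  refine exists_fusionExpr_of_add_vertex f (Sum.inl (Fin.last p)) ?_ ?_ he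
  · rintro (s | x)
    · exact Sum.inl_injective.ne (Fin.castSucc_lt_last s).ne
    · exact Sum.inr_ne_inl
  · rintro (s | x)
    · induction s using Fin.lastCases with
      | last => exact Or.inl rfl
      | cast s => exact Or.inr ⟨Sum.inl s, rfl⟩
    · exact Or.inr ⟨Sum.inr x, rfl⟩

theorem exists_fusionExpr_apexGraph (P h p : ℕ) :
    ∃ e : FusionExpr (3 + p), Nonempty (e.eval.graph ≃g apexGraph P h p) := by
  induction p with
  | zero =>
    refine ⟨treeExpr _ h, ⟨⟨(Equiv.emptySum (Fin 0) _).symm, ?_⟩⟩⟩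
    intro x y
    exact Iff.rfl
  | succ p ih => exact exists_fusionExpr_apexGraph_succ ih

/-! ### Widths are attained; choice of the number of apices -/

theorem fusionWidth_spec {k : ℕ} {V : Type*} {G : SimpleGraph V}
    (h : ∃ e : FusionExpr k, Nonempty (e.eval.graph ≃g G)) :
    ∃ e : FusionExpr (fusionWidth G), Nonempty (e.eval.graph ≃g G) :=
  Nat.sInf_mem (s := {k : ℕ | ∃ e : FusionExpr k, Nonempty (e.eval.graph ≃g G)}) ⟨k, h⟩

theorem fusionWidth_le {k : ℕ} {V : Type*} {G : SimpleGraph V}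
    (h : ∃ e : FusionExpr k, Nonempty (e.eval.graph ≃g G)) : fusionWidth G ≤ k :=
  Nat.sInf_le h

theorem fusionWidth_apexGraph_succ_le (P h p : ℕ) :
    fusionWidth (apexGraph P h (p + 1)) ≤ fusionWidth (apexGraph P h p) + 1 :=
  fusionWidth_le (exists_fusionExpr_apexGraph_succ
    (fusionWidth_spec (exists_fusionExpr_apexGraph P h p)))

theorem exists_cliqueExpr_edgeless {n : ℕ} (S : Finset (Fin n)) (hS : S.Nonempty) :
    ∃ e : CliqueExpr n, Function.Injective e.eval.label ∧ range e.eval.label = S ∧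
      ∀ x y, ¬ e.eval.graph.Adj x y := by
  induction hS using Finset.Nonempty.cons_induction with
  | singleton a =>
    refine ⟨.vertex a, fun x y _ => Subsingleton.elim (α := Fin 1) x y, ?_, fun _ _ h => h⟩
    rw [Finset.coe_singleton]
    exact range_const (ι := Fin 1) (c := a)
  | cons a S ha _ ih =>
    obtain ⟨e, hinj, hr, hadj⟩ := ih
    have hne : ∀ x, e.eval.label x ≠ a := by
      rintro x rfl
      exact ha (by rw [← Finset.mem_coe, ← hr]; exact ⟨x, rfl⟩)
    refine ⟨.disjUnion (.vertex a) e, ?_, ?_, ?_⟩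
    · rintro (x | x) (y | y) h
      · exact congrArg Sum.inl (Subsingleton.elim (α := Fin 1) x y)
      · exact absurd h.symm (hne y)
      · exact absurd h (hne x)
      · exact congrArg Sum.inr (hinj h)
    · refine (Sum.elim_range _ _).trans ?_
      rw [hr, Finset.coe_cons, Set.insert_eq]
      exact congrArg (· ∪ (S : Set (Fin n))) (range_const (ι := Fin 1) (c := a))
    · rintro (x | x) (y | y)
      · exact fun h => h
      · exact not_disjUnion_adj_inl_inr _ _ _ _
      · exact not_disjUnion_adj_inr_inl _ _ _ _
      · exact hadj x y

/-- Every finite nonempty graph is generated by an expression with one label for each vertex. -/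
theorem exists_cliqueExpr {V : Type*} [Finite V] [Nonempty V] (G : SimpleGraph V) :
    ∃ k, ∃ e : CliqueExpr k, Nonempty (e.eval.graph ≃g G) := by
  classical
  obtain ⟨n, ⟨φ⟩⟩ := Finite.exists_equiv_fin V
  have hn : (Finset.univ : Finset (Fin n)).Nonempty := ⟨φ (Classical.arbitrary V), by simp⟩
  have key : ∀ E : Finset (Fin n × Fin n), (∀ a ∈ E, a.1 ≠ a.2) →
      ∃ e : CliqueExpr n, Function.Bijective e.eval.label ∧ ∀ x y, e.eval.graph.Adj x y ↔
        (e.eval.label x, e.eval.label y) ∈ E ∨ (e.eval.label y, e.eval.label x) ∈ E := by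
    intro E
    induction E using Finset.induction_on with
    | empty =>
      intro _
      obtain ⟨e, hinj, hr, hadj⟩ := exists_cliqueExpr_edgeless _ hn
      exact ⟨e, ⟨hinj, range_eq_univ.1 (by simpa using hr)⟩, by simpa using hadj⟩
    | insert a E _ ih =>
      intro hE
      obtain ⟨e, hbij, hadj⟩ := ih fun b hb => hE b (Finset.mem_insert_of_mem hb)
      have ha := hE a (Finset.mem_insert_self _ _)
      refine ⟨.addEdges a.1 a.2 ha e, hbij, ?_⟩
      have h : ∀ x y : e.eval.V, (e.eval.addEdges a.1 a.2).graph.Adj x y ↔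
          (e.eval.label x, e.eval.label y) ∈ insert a E ∨
            (e.eval.label y, e.eval.label x) ∈ insert a E := by
        intro x y
        rw [addEdges_adj, hadj, Finset.mem_insert, Finset.mem_insert, Prod.ext_iff, Prod.ext_iff]
        constructor
        · tauto
        · have : (e.eval.label x = a.1 ∧ e.eval.label y = a.2) ∨
              (e.eval.label y = a.1 ∧ e.eval.label x = a.2) → x ≠ y := by
            rintro (⟨h₁, h₂⟩ | ⟨h₁, h₂⟩) rfl
            · exact ha (h₁.symm.trans h₂)
            · exact ha (h₁.symm.trans h₂)
          tauto
      exact h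
  obtain ⟨e, hbij, hadj⟩ := key
    (Finset.univ.filter fun a => G.Adj (φ.symm a.1) (φ.symm a.2))
    (fun a ha he => by
      rw [Finset.mem_filter, he] at ha
      exact G.irrefl ha.2)
  refine ⟨n, e, ⟨⟨(Equiv.ofBijective _ hbij).trans φ.symm, ?_⟩⟩⟩
  intro x y
  rw [hadj]
  simp [G.adj_comm (φ.symm (e.eval.label y))]

/-- Existence of some expression matters here: the infimum of the empty set would be 0. -/
theorem cliqueWidth_spec {V : Type*} [Finite V] [Nonempty V] (G : SimpleGraph V) :
    ∃ e : CliqueExpr (cliqueWidth G), Nonempty (e.eval.graph ≃g G) :=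
  Nat.sInf_mem (s := {k : ℕ | ∃ e : CliqueExpr k, Nonempty (e.eval.graph ≃g G)})
    (exists_cliqueExpr G)

theorem cliqueWidth_pos {V : Type*} [Finite V] [Nonempty V] (G : SimpleGraph V) :
    1 ≤ cliqueWidth G := by
  obtain ⟨e, -⟩ := cliqueWidth_spec G
  obtain ⟨i⟩ := e.nonempty_fin
  exact i.pos

theorem fusionWidth_pos {k : ℕ} {V : Type*} {G : SimpleGraph V}
    (h : ∃ e : FusionExpr k, Nonempty (e.eval.graph ≃g G)) : 1 ≤ fusionWidth G := by
  obtain ⟨e, -⟩ := fusionWidth_spec h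
  obtain ⟨i⟩ := e.nonempty_fin
  exact i.pos

theorem FusionExpr.not_adj_of_one (e : FusionExpr 1) (x y : e.eval.V) :
    ¬ e.eval.graph.Adj x y := by
  induction e with
  | isolated i m => exact fun h => h
  | addEdges i j hij e ih => exact absurd (Subsingleton.elim i j) hij
  | relabel i j e ih => exact ih x y
  | merge i e ih =>
    intro h
    obtain ⟨-, x', y', -, -, h⟩ := (merge_adj _ _ _ _).1 h
    exact ih x' y' h
  | disjUnion e f ihe ihf =>
    rcases x with x | x <;> rcases y with y | y
    · exact ihe x y
    · exact not_disjUnion_adj_inl_inr _ _ _ _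
    · exact not_disjUnion_adj_inr_inl _ _ _ _
    · exact ihf x y

theorem exists_fusionWidth_eq_one :
    ∃ (V : Type) (_ : Finite V) (_ : Nonempty V) (G : SimpleGraph V), fusionWidth G = 1 := by
  let e : FusionExpr 1 := .isolated 0 1
  have h : ∃ e' : FusionExpr 1, Nonempty (e'.eval.graph ≃g e.eval.graph) := ⟨e, ⟨.refl⟩⟩
  exact ⟨e.eval.V, inferInstance, ⟨(0 : Fin 1)⟩, e.eval.graph,
    (fusionWidth_le h).antisymm (fusionWidth_pos h)⟩

theorem exists_fusionWidth_eq_two :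
    ∃ (V : Type) (_ : Finite V) (_ : Nonempty V) (G : SimpleGraph V), fusionWidth G = 2 := by
  let e : FusionExpr 2 := .addEdges 0 1 (by decide) (.disjUnion (.isolated 0 1) (.isolated 1 1))
  have h : ∃ e' : FusionExpr 2, Nonempty (e'.eval.graph ≃g e.eval.graph) := ⟨e, ⟨.refl⟩⟩
  refine ⟨e.eval.V, inferInstance, ⟨(Sum.inl 0 : Fin 1 ⊕ Fin 1)⟩, e.eval.graph,
    (fusionWidth_le h).antisymm ?_⟩
  by_contra hlt
  have hone : fusionWidth e.eval.graph = 1 := by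
    have := fusionWidth_pos h
    omega
  obtain ⟨e', ⟨φ⟩⟩ := hone ▸ fusionWidth_spec h
  have hadj : e.eval.graph.Adj (Sum.inl 0 : Fin 1 ⊕ Fin 1) (Sum.inr 0 : Fin 1 ⊕ Fin 1) :=
    (addEdges_adj _ _ _ _ _).2 (Or.inr ⟨Sum.inl_ne_inr, Or.inl ⟨rfl, rfl⟩⟩)
  exact e'.not_adj_of_one _ _ (φ.symm.map_rel_iff.2 hadj)

theorem two_pow_le_cliqueWidth_apexGraph {P h p : ℕ} (hp : p ≤ P) (hh : 2 ^ (p / 2) ≤ h) :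
    2 ^ (p / 2) ≤ cliqueWidth (apexGraph P h p) := by
  obtain ⟨x, -⟩ := exists_treeLabel_eq_zero (Fintype.card (LeafType P)) h
  have : Nonempty (ApexVertex P h p) := ⟨Sum.inr x⟩
  by_contra! hlt
  exact not_exists_cliqueExpr_apexGraph hp hlt (hlt.le.trans hh) (cliqueWidth_spec _)

theorem lt_fusionWidth_apexGraph {k P h : ℕ} (hP : 3 * k + 10 ≤ P) (hh : 2 * k ≤ h) :
    k < fusionWidth (apexGraph P h P) := by
  by_contra! hle
  set c := fusionWidth (apexGraph P h P) with hc
  refine not_exists_fusionExpr_apexGraph (c := c) le_rfl ?_ (by omega)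
    (fusionWidth_spec (exists_fusionExpr_apexGraph P h P))
  -- As `c ≤ k` and `P ≥ 3 * k + 10`, the exponent `(P - c) / 2` is at least `c + 1`.
  calc 2 * c < 2 * 2 ^ c := by
        have := c.lt_two_pow_self
        omega
    _ = 2 ^ (c + 1) := by ring
    _ ≤ 2 ^ ((P - c) / 2) := Nat.pow_le_pow_right (by norm_num) (by omega)

theorem exists_fusionWidth_eq_and_le_cliqueWidth {k : ℕ} (hk : 3 ≤ k) :
    ∃ (V : Type) (_ : Finite V) (_ : Nonempty V) (G : SimpleGraph V),
      fusionWidth G = k ∧ 2 ^ ((k - 3) / 2) ≤ cliqueWidth G := by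
  classical
  obtain ⟨P, hP⟩ : ∃ P, P = 3 * k + 10 := ⟨_, rfl⟩
  -- One height serves both bounds: `2 * k` for the fusion-width and `2 ^ P ≥ 2 ^ (p / 2)` for the
  -- clique-width, before `p` is known.
  obtain ⟨h, hh⟩ : ∃ h, h = 2 ^ P + 2 * k := ⟨_, rfl⟩
  have hPk : k < fusionWidth (apexGraph P h P) :=
    lt_fusionWidth_apexGraph hP.ge (hh ▸ Nat.le_add_left _ _)
  have hex : ∃ p, k ≤ fusionWidth (apexGraph P h p) :=
    ⟨P, hPk.le⟩
  -- Discrete intermediate values: the fusion-width starts at most at `3 ≤ k` and rises by at most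
  -- one per apex, so it equals `k` at the first `p` where it reaches `k`.
  obtain ⟨p, hp⟩ : ∃ p, p = Nat.find hex := ⟨_, rfl⟩
  have hkp : k ≤ fusionWidth (apexGraph P h p) := hp ▸ Nat.find_spec hex
  have hpP : p ≤ P := hp ▸ Nat.find_min' hex hPk.le
  have hle := fusionWidth_le (exists_fusionExpr_apexGraph P h p)
  have hpk : fusionWidth (apexGraph P h p) = k := by
    refine le_antisymm ?_ hkp
    cases p with
    | zero => omega
    | succ p =>
      have h₁ := fusionWidth_apexGraph_succ_le P h p
      have h₂ := Nat.find_min hex (m := p) (by omega)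
      omega
  obtain ⟨x, -⟩ := exists_treeLabel_eq_zero (Fintype.card (LeafType P)) h
  refine ⟨ApexVertex P h p, inferInstance, ⟨Sum.inr x⟩, apexGraph P h p, hpk, ?_⟩
  refine le_trans (Nat.pow_le_pow_right (by norm_num) (by omega))
    (two_pow_le_cliqueWidth_apexGraph hpP ?_)
  have : 2 ^ (p / 2) ≤ 2 ^ P := Nat.pow_le_pow_right (by norm_num) (by omega)
  rw [hh]
  exact this.trans (Nat.le_add_right _ _)

end FusionWidth

theorem mainTheorem3 (k : ℕ) (hk : 1 ≤ k) :
    ∃ (V : Type) (_ : Finite V) (_ : Nonempty V) (G : SimpleGraph V),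
      FusionWidth.fusionWidth G = k ∧
      (2 : ℝ) ^ (((k / 2 : ℕ) : ℤ) - 2) ≤ (FusionWidth.cliqueWidth G : ℝ) := by
  rcases Nat.lt_or_ge k 3 with h3 | h3
  · obtain ⟨V, hV, hV', G, hG⟩ : ∃ (V : Type) (_ : Finite V) (_ : Nonempty V) (G : SimpleGraph V),
        FusionWidth.fusionWidth G = k := by
      obtain rfl | rfl : k = 1 ∨ k = 2 := by omega
      · exact FusionWidth.exists_fusionWidth_eq_one
      · exact FusionWidth.exists_fusionWidth_eq_two
    refine ⟨V, hV, hV', G, hG, ?_⟩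
    -- For `k < 3` the exponent is negative, so positivity of the clique-width suffices.
    refine (zpow_le_one_of_nonpos₀ one_le_two (by omega)).trans ?_
    exact_mod_cast FusionWidth.cliqueWidth_pos G
  · obtain ⟨V, hV, hV', G, hG, hle⟩ := FusionWidth.exists_fusionWidth_eq_and_le_cliqueWidth h3
    refine ⟨V, hV, hV', G, hG, ?_⟩
    calc (2 : ℝ) ^ (((k / 2 : ℕ) : ℤ) - 2) ≤ 2 ^ (((k - 3) / 2 : ℕ) : ℤ) :=
          zpow_le_zpow_right₀ one_le_two (by omega)
      _ ≤ _ := by rw [zpow_natCast]; exact_mod_cast hle
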